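/- For $a\in\mathbb R$ and $b>0$ let $\operatorname{Var}^{IG}(a,b)$ be the variance of the integer-valued Gaussian $X$ with $\mathbb P[X=k]\propto e^{-\frac b2(k-a)^2}$, $k\in\mathbb Z$, and for $\beta>0$ let $$M(\beta)=(2\pi)^2\beta\inf_{a\in[0,1/2]}\operatorname{Var}^{IG}\bigl(a,(2\pi)^2\beta\bigr).$$ For $n\ge 0$ let $\Lambda_n=[-n,n]^2\cap\mathbb Z^2$. The integer-valued Gaussian free field on $\Lambda_n$ with Dirichlet boundary conditions at inverse temperature $\beta^{-1}$ is the random function $\Psi:\Lambda_n\to\mathbb Z$ with law $$\mathbb P^{IV}_{\beta^{-1},n}(\Psi)\propto\exp\Bigl(-\frac1{2\beta}\langle\Psi,(-\Delta)\Psi\rangle\Bigr),$$ where $\Psi$ is extended by $0$ to $\mathbb Z^2$, $(\Delta\Psi)(v)=\sum_{w\sim v}(\Psi(w)-\Psi(v))$ (sum over the four neighbours of $v$ in $\mathbb Z^2$) and $\langle f,g\rangle=\sum_{v\in\Lambda_n}f(v)g(v)$. Let $\beta>0$. Then for every $n$ this law is a well-defined probability measure (its weights have finite sum), and $$\mathbb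 P^{IV}_{\beta^{-1},n}\Bigl[\max_{v\in\Lambda_n}\Psi(v)\le\sqrt{\tfrac{\left(1-\frac{M(\beta)}2\right)2\beta}{\pi}}\,\log n\Bigr]\longrightarrow1\qquad(n\to\infty).$$ More precisely, for every $\hat\beta>\tilde\beta:=(1-M(\beta))\beta$, $$\mathbb P^{IV}_{\beta^{-1},n}\Bigl[\max_{v\in\Lambda_n}\Psi(v)\ge\frac{2}{\sqrt{2\pi\hat\beta^{-1}}}\,\log n\Bigr]\longrightarrow0\qquad(n\to\infty).$$ -/

import Mathlib

open MeasureTheory ProbabilityTheory Filter Topology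

noncomputable section

namespace IVGFF

/-- The Gibbs measure on a (countable) space with Hamiltonian `H`: the point `x` has mass
proportional to `exp (-H x)`. -/
def gibbs {α : Type*} [MeasurableSpace α] (H : α → ℝ) : Measure α :=
  (∑' x, ENNReal.ofReal (Real.exp (-H x)))⁻¹ •
    Measure.sum (fun x => ENNReal.ofReal (Real.exp (-H x)) • Measure.dirac x)

/-- The law of the integer-valued Gaussian centred at `a` with inverse temperature `β`:
`ℙ[X = k] ∝ exp (-(β / 2) * (k - a) ^ 2)` for `k : ℤ`. -/
def integerGaussian (a β : ℝ) : Measure ℤ :=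
  gibbs (fun k : ℤ => β / 2 * ((k : ℝ) - a) ^ 2)

/-- The variance `Var^{IG}(a, β)` of the integer-valued Gaussian. -/
def varIG (a β : ℝ) : ℝ :=
  variance (fun k : ℤ => (k : ℝ)) (integerGaussian a β)

/-- The error function
`M(β) = (2π)² β inf_{a ∈ [0, 1/2]} Var^{IG}(a, (2π)² β)`. -/
def errorM (β : ℝ) : ℝ :=
  (2 * Real.pi) ^ 2 * β * ⨅ a : Set.Icc (0 : ℝ) (1 / 2), varIG a ((2 * Real.pi) ^ 2 * β)

/-- The box `Λ_n = [-n, n]² ∩ ℤ²`. -/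
def box (n : ℕ) : Finset (ℤ × ℤ) :=
  Finset.Icc (-(n : ℤ)) (n : ℤ) ×ˢ Finset.Icc (-(n : ℤ)) (n : ℤ)

/-- Dirichlet boundary conditions: an integer-valued function on `Λ_n`, extended by `0` to `ℤ²`.
Identifying all the exterior vertices with one vertex `∞`, at which the field vanishes, gives
the graph dual to a rectangular grid. -/
def extendZero {n : ℕ} (Ψ : box n → ℤ) (v : ℤ × ℤ) : ℝ :=
  if h : v ∈ box n then (Ψ ⟨v, h⟩ : ℝ) else 0

/-- The (negative) graph Laplacian of `ℤ²`. -/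
def laplacian (f : ℤ × ℤ → ℝ) (v : ℤ × ℤ) : ℝ :=
  (f (v.1 + 1, v.2) - f v) + (f (v.1 - 1, v.2) - f v) +
    (f (v.1, v.2 + 1) - f v) + (f (v.1, v.2 - 1) - f v)

/-- The Dirichlet energy `⟨Ψ, (-Δ) Ψ⟩` on `Λ_n` with zero boundary conditions. -/
def energy {n : ℕ} (Ψ : box n → ℤ) : ℝ :=
  ∑ v : box n, (Ψ v : ℝ) * (-laplacian (extendZero Ψ) v)

/-- The law of the integer-valued Gaussian free field on `Λ_n` with Dirichlet boundary conditions
at inverse temperature `β⁻¹`: `ℙ(Ψ) ∝ exp (-(1 / (2β)) ⟨Ψ, (-Δ) Ψ⟩)`. -/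
def law (β : ℝ) (n : ℕ) : Measure (box n → ℤ) :=
  gibbs (fun Ψ : box n → ℤ => 1 / (2 * β) * energy Ψ)

/-- The maximum of the field over `Λ_n` (a finite non-empty set). -/
def fieldMax {n : ℕ} (Ψ : box n → ℤ) : ℝ :=
  ⨆ v : box n, (Ψ v : ℝ)

end IVGFF

end

namespace IVGFF

/-! ### Sums over lattices and positive definite functions -/

/-! The field at a vertex has a Laplace transform bounded, up to lower-order terms, by that of a
Gaussian of variance `(1 - M(β)) β log n / (2π)`; a Chernoff estimate and a union bound over the
`(2n+1)²` vertices then give the result. The first limit is the case `β' = (1 - M(β)/2) β` of the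
second, since `M(β) > 0`.

To bound the Laplace transform, pair the gradient of `Ψ` with a unit flow out of `v`: by summation
by parts this recovers `Ψ v` up to sign (`sum_flow_mul_gradient`). Inserting `exp (l Ψ v)` therefore
tilts each edge weight `exp (-n² / (2β))` by a factor `exp (s n)`, where `s` is `-l` times the flow.
By Poisson summation (`symbol_edgeWeight`) the Fourier series of a tilted weight is, up to a phase,
`exp (β s² / 2)` times the untilted one times the characteristic function of an integer-valued
Gaussian at `-2πβs`. A Taylor bound on that characteristic function gains the factor `exp (-β M(β)
s² / 2 + O(s⁴))` (`norm_symbol_edgeWeight_le`).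

The untilted Fourier series is nonnegative. Pointwise domination of Fourier series passes to sums
over differences `x - y` in finite sets, because these are integrals against a squared modulus, and
an averaging argument over large cubes transfers it to the partition functions
(`sum_prod_le_of_norm_symbol_le`).

The flow is explicit: the angle under which a dual edge is seen from `v`, divided by `2π`. Its
energy is at most `log n / (2π) + 3` and its fourth powers have bounded sum (`sum_flow_sq_le`,
`sum_flow_pow_four_le`), so the quartic errors cost only a constant. -/

theorem summable_pi_prod {ι : Type*} [Fintype ι] {f : ι → ℤ → ℝ} (hf0 : ∀ i n, 0 ≤ f i n)
    (hf : ∀ i, Summable (f i)) : Summable fun x : ι → ℤ => ∏ i, f i (x i) := by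
  classical
  refine summable_of_sum_le (c := ∏ i, ∑' n, f i n)
    (fun x => Finset.prod_nonneg fun i _ => hf0 i _) fun F => ?_
  calc ∑ x ∈ F, ∏ i, f i (x i)
      ≤ ∑ x ∈ Fintype.piFinset (fun i => F.image (fun x => x i)), ∏ i, f i (x i) := by
        refine Finset.sum_le_sum_of_subset_of_nonneg (fun x hx => ?_)
          (fun x _ _ => Finset.prod_nonneg fun i _ => hf0 i _)
        rw [Fintype.mem_piFinset]
        exact fun i => Finset.mem_image_of_mem _ hx
    _ = ∏ i, ∑ n ∈ F.image (fun x => x i), f i n := (Finset.prod_univ_sum _ _).symm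
    _ ≤ ∏ i, ∑' n, f i n :=
        Finset.prod_le_prod (fun i _ => Finset.sum_nonneg fun n _ => hf0 i n)
          (fun i _ => (hf i).sum_le_tsum _ fun n _ => hf0 i n)

/-- If `k` is dominated by `k₀` on average over differences in all finite sets, then the sums of
`k` are dominated by the sum of `k₀`. -/
theorem sum_le_of_forall_sum_sub_le {V : Type*} [Fintype V] {k k₀ : (V → ℤ) → ℝ} {C : ℝ}
    (hC : 0 ≤ C) (hk : ∀ z, 0 ≤ k z) (hk₀ : ∀ z, 0 ≤ k₀ z) (hs : Summable k₀)
    (h : ∀ B : Finset (V → ℤ), ∑ x ∈ B, ∑ y ∈ B, k (x - y) ≤ C * ∑ x ∈ B, ∑ y ∈ B, k₀ (x - y))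
    (F : Finset (V → ℤ)) : ∑ z ∈ F, k z ≤ C * ∑' z, k₀ z := by
  classical
  obtain ⟨R, hR⟩ : ∃ R : ℕ, ∀ z ∈ F, ∀ i, |z i| ≤ R := by
    refine ⟨∑ z ∈ F, ∑ i, (z i).natAbs, fun z hz i => ?_⟩
    have h1 : (z i).natAbs ≤ ∑ i, (z i).natAbs :=
      Finset.single_le_sum (f := fun i => (z i).natAbs) (fun _ _ => Nat.zero_le _)
        (Finset.mem_univ i)
    have h2 : ∑ i, (z i).natAbs ≤ ∑ z ∈ F, ∑ i, (z i).natAbs :=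
      Finset.single_le_sum (f := fun z : V → ℤ => ∑ i, (z i).natAbs) (fun _ _ => Nat.zero_le _) hz
    rw [Int.abs_eq_natAbs]
    exact_mod_cast h1.trans h2
  set d := Fintype.card V
  -- For `y` in the inner cube `B'`, at distance `R` from the faces of `B`, every `z ∈ F` equals `x
  -- - y` for some `x ∈ B`. Each `k z` thus occurs at least `|B'|` times in the double sum, while
  -- the sum of `k₀` is counted at most `|B|` times. The ratio of the cardinalities tends to 1.
  have key : ∀ N : ℕ, 2 * R < N →
      (((N : ℝ) - 2 * R) / N) ^ d * ∑ z ∈ F, k z ≤ C * ∑' z, k₀ z := by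
    intro N hN
    have hN0 : (0 : ℝ) < N := by exact_mod_cast (Nat.zero_le _).trans_lt hN
    set B : Finset (V → ℤ) := Fintype.piFinset fun _ => Finset.Ico 0 (N : ℤ)
    set B' : Finset (V → ℤ) := Fintype.piFinset fun _ => Finset.Ico (R : ℤ) (N - R)
    have hB : (B.card : ℝ) = (N : ℝ) ^ d := by
      simp [B, Fintype.card_piFinset, d]
    have hB' : (B'.card : ℝ) = ((N : ℝ) - 2 * R) ^ d := by
      have : ((N : ℤ) - R - R).toNat = N - 2 * R := by omega
      simp only [B', Fintype.card_piFinset, Int.card_Ico, this, Finset.prod_const,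
        Finset.card_univ, d]
      push_cast [Nat.cast_sub hN.le]
      ring
    have hlow : (B'.card : ℝ) * ∑ z ∈ F, k z ≤ ∑ x ∈ B, ∑ y ∈ B, k (x - y) := by
      rw [Finset.sum_comm, ← nsmul_eq_mul, ← Finset.sum_const]
      have hsub : B' ⊆ B := by
        intro y hy
        simp only [B, B', Fintype.mem_piFinset, Finset.mem_Ico] at hy ⊢
        intro i; have := hy i; omega
      refine (Finset.sum_le_sum fun y hy => ?_).trans
        (Finset.sum_le_sum_of_subset_of_nonneg hsub fun y _ _ => Finset.sum_nonneg fun x _ => hk _)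
      have hinj : Set.InjOn (fun z : V → ℤ => z + y) (F : Set (V → ℤ)) :=
        fun a _ b _ hab => add_right_cancel hab
      calc ∑ z ∈ F, k z = ∑ x ∈ F.image (fun z => z + y), k (x - y) := by
            rw [Finset.sum_image hinj]; simp
        _ ≤ ∑ x ∈ B, k (x - y) := by
            refine Finset.sum_le_sum_of_subset_of_nonneg ?_ fun x _ _ => hk _
            intro x hx
            obtain ⟨z, hz, rfl⟩ := Finset.mem_image.1 hx
            simp only [B, B', Fintype.mem_piFinset, Finset.mem_Ico, Pi.add_apply] at hy ⊢
            intro i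
            have h1 := hy i
            have h2 := abs_le.1 (hR z hz i)
            omega
    have hup : ∑ x ∈ B, ∑ y ∈ B, k₀ (x - y) ≤ (B.card : ℝ) * ∑' z, k₀ z := by
      rw [Finset.sum_comm, ← nsmul_eq_mul, ← Finset.sum_const]
      refine Finset.sum_le_sum fun y _ => ?_
      have hinj : Set.InjOn (fun x : V → ℤ => x - y) (B : Set (V → ℤ)) :=
        fun a _ b _ hab => sub_left_injective hab
      rw [← Finset.sum_image (f := k₀) hinj]
      exact hs.sum_le_tsum _ fun z _ => hk₀ z
    have := hlow.trans ((h B).trans (mul_le_mul_of_nonneg_left hup hC))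
    rw [hB, hB'] at this
    rw [div_pow, div_mul_eq_mul_div, div_le_iff₀ (pow_pos hN0 d)]
    linarith
  have hlim : Tendsto (fun N : ℕ => (((N : ℝ) - 2 * R) / N) ^ d * ∑ z ∈ F, k z) atTop
      (𝓝 (1 ^ d * ∑ z ∈ F, k z)) := by
    refine Tendsto.mul_const _ (Tendsto.pow ?_ d)
    have h1 : Tendsto (fun N : ℕ => (1 : ℝ) - (2 * R) / N) atTop (𝓝 (1 - 0)) :=
      tendsto_const_nhds.sub (tendsto_const_div_atTop_nhds_zero_nat _)
    rw [sub_zero] at h1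
    refine h1.congr' ?_
    filter_upwards [eventually_gt_atTop 0] with N hN
    have : (N : ℝ) ≠ 0 := by exact_mod_cast hN.ne'
    field_simp
  rw [one_pow, one_mul] at hlim
  exact le_of_tendsto hlim ((eventually_gt_atTop (2 * R)).mono key)

/-! ### Fourier series on the circle and positive definiteness. -/

/-- The Fourier series with coefficients `g`. -/
noncomputable def symbol (g : ℤ → ℝ) (t : UnitAddCircle) : ℂ := ∑' n, (g n : ℂ) * fourier n t

theorem norm_fourier_apply (n : ℤ) (t : UnitAddCircle) : ‖fourier n t‖ = 1 := by
  rw [fourier_apply]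
  exact Circle.norm_coe _

theorem continuous_symbol {g : ℤ → ℝ} (hg : Summable fun n => |g n|) : Continuous (symbol g) := by
  refine continuous_tsum (fun n => continuous_const.mul (fourier n).continuous) hg fun n t => ?_
  rw [norm_mul, norm_fourier_apply, mul_one, Complex.norm_real, Real.norm_eq_abs]

theorem integrable_of_continuous {f : UnitAddCircle → ℂ} (hf : Continuous f) :
    Integrable f AddCircle.haarAddCircle := by
  rw [← integrableOn_univ]
  exact hf.continuousOn.integrableOn_compact isCompact_univ

theorem integral_symbol_mul_fourier {g : ℤ → ℝ} (hg : Summable fun n => |g n|) (m : ℤ) :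
    ∫ t, symbol g t * fourier (-m) t ∂AddCircle.haarAddCircle = g m := by
  have h1 : ∀ t : UnitAddCircle, symbol g t * fourier (-m) t
      = ∑' n, (g n : ℂ) * fourier n t * fourier (-m) t := fun t => tsum_mul_right.symm
  simp_rw [h1]
  have hint : ∀ n : ℤ, ∫ t : UnitAddCircle, (g n : ℂ) * fourier n t * fourier (-m) t
      ∂AddCircle.haarAddCircle = if n = m then (g m : ℂ) else 0 := by
    intro n
    have := congrFun (fourierCoeff_fourier (T := 1) n) m
    unfold fourierCoeff at this
    simp_rw [mul_assoc, integral_const_mul]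
    simp_rw [smul_eq_mul, mul_comm (fourier (-m) _)] at this
    rw [this, Pi.single_apply]
    by_cases h : n = m
    · simp [h]
    · simp [h, Ne.symm h]
  have := hasSum_integral_of_summable_integral_norm (μ := AddCircle.haarAddCircle)
    (F := fun (n : ℤ) (t : UnitAddCircle) => (g n : ℂ) * fourier n t * fourier (-m) t)
    (fun n => integrable_of_continuous (by fun_prop)) (by
      simpa [norm_fourier_apply, -fourier_apply] using hg)
  rw [← this.tsum_eq]
  simp_rw [hint]
  rw [tsum_ite_eq]

theorem prod_eq_integral_symbol {ι : Type*} [Fintype ι] {g : ι → ℤ → ℝ}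
    (hg : ∀ e, Summable fun n => |g e n|) (m : ι → ℤ) :
    ((∏ e, g e (m e) : ℝ) : ℂ) = ∫ t : ι → UnitAddCircle,
      (∏ e, symbol (g e) (t e)) * ∏ e, fourier (-(m e)) (t e)
        ∂Measure.pi fun _ => AddCircle.haarAddCircle := by
  simp_rw [← Finset.prod_mul_distrib]
  rw [integral_fintype_prod_eq_prod (f := fun e t => symbol (g e) t * fourier (-(m e)) t)]
  push_cast
  exact Finset.prod_congr rfl fun e _ => (integral_symbol_mul_fourier (hg e) _).symm

/-- The characters attached to `D (x - y)` factor as one for `x` times the conjugate of one for `y`,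
so the double sum over `B` turns into a squared modulus. Its nonnegativity is what makes bounds on
the symbols usable. -/
theorem sum_sub_eq_integral {ι V : Type*} [Fintype ι] {g : ι → ℤ → ℝ}
    (hg : ∀ e, Summable fun n => |g e n|) (D : (V → ℤ) →+ (ι → ℤ)) (B : Finset (V → ℤ)) :
    ((∑ x ∈ B, ∑ y ∈ B, ∏ e, g e (D (x - y) e) : ℝ) : ℂ) = ∫ t : ι → UnitAddCircle,
      (∏ e, symbol (g e) (t e)) * ((‖∑ x ∈ B, ∏ e, fourier (-(D x e)) (t e)‖ ^ 2 : ℝ) : ℂ)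
        ∂Measure.pi fun _ => AddCircle.haarAddCircle := by
  have hsq : ∀ t : ι → UnitAddCircle,
      ((‖∑ x ∈ B, ∏ e, fourier (-(D x e)) (t e)‖ ^ 2 : ℝ) : ℂ)
        = ∑ x ∈ B, ∑ y ∈ B, ∏ e, fourier (-(D (x - y) e)) (t e) := by
    intro t
    push_cast
    rw [← Complex.mul_conj', map_sum, Finset.sum_mul_sum]
    refine Finset.sum_congr rfl fun x _ => Finset.sum_congr rfl fun y _ => ?_
    rw [map_prod, ← Finset.prod_mul_distrib]
    refine Finset.prod_congr rfl fun e _ => ?_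
    rw [← fourier_neg, ← fourier_add, map_sub, Pi.sub_apply]
    congr 2
    ring
  simp_rw [hsq, Finset.mul_sum]
  have hF : ∀ x y : V → ℤ, Integrable (fun t : ι → UnitAddCircle =>
      (∏ e, symbol (g e) (t e)) * ∏ e, fourier (-(D (x - y) e)) (t e))
      (Measure.pi fun _ => AddCircle.haarAddCircle) := by
    intro x y
    simp_rw [← Finset.prod_mul_distrib]
    exact Integrable.fintype_prod
      (f := fun e t => symbol (g e) t * fourier (-(D (x - y) e)) t) fun e =>
        integrable_of_continuous ((continuous_symbol (hg e)).mul (fourier _).continuous)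
  rw [integral_finsetSum _ fun x _ => integrable_finsetSum _ fun y _ => hF x y]
  push_cast
  refine Finset.sum_congr rfl fun x _ => ?_
  rw [integral_finsetSum _ fun y _ => hF x y]
  refine Finset.sum_congr rfl fun y _ => ?_
  rw [← prod_eq_integral_symbol hg]
  push_cast
  rfl

/-- Comparison of two lattice sums of product weights composed with a homomorphism, given the
pointwise domination of the Fourier series of the weights. -/
theorem sum_prod_le_of_norm_symbol_le {ι V : Type*} [Fintype ι] [Fintype V] {g g₀ : ι → ℤ → ℝ}
    (hg : ∀ e, Summable (g e)) (hg₀ : ∀ e, Summable (g₀ e)) (hg' : ∀ e n, 0 ≤ g e n)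
    (hg₀' : ∀ e n, 0 ≤ g₀ e n) (D : (V → ℤ) →+ (ι → ℤ))
    (hs : Summable fun z => ∏ e, g₀ e (D z e)) {C : ι → ℝ} (hC : ∀ e, 0 ≤ C e)
    {r : ι → UnitAddCircle → ℝ} (hr : ∀ e t, symbol (g₀ e) t = r e t)
    (h : ∀ e t, ‖symbol (g e) t‖ ≤ C e * r e t) (F : Finset (V → ℤ)) :
    ∑ z ∈ F, ∏ e, g e (D z e) ≤ (∏ e, C e) * ∑' z, ∏ e, g₀ e (D z e) := by
  have ha : ∀ e, Summable fun n => |g e n| := fun e => (hg e).abs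
  have ha₀ : ∀ e, Summable fun n => |g₀ e n| := fun e => (hg₀ e).abs
  refine sum_le_of_forall_sum_sub_le (Finset.prod_nonneg fun e _ => hC e)
    (fun z => Finset.prod_nonneg fun e _ => hg' e _)
    (fun z => Finset.prod_nonneg fun e _ => hg₀' e _) hs (fun B => ?_) F
  set μ : Measure (ι → UnitAddCircle) := Measure.pi fun _ => AddCircle.haarAddCircle
  set S : (ι → UnitAddCircle) → ℝ :=
    fun t => ‖∑ x ∈ B, ∏ e, fourier (-(D x e)) (t e)‖ ^ 2
  have hS : Continuous S := by
    refine Continuous.pow (Continuous.norm ?_) 2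
    exact continuous_finsetSum _ fun x _ => continuous_finsetProd _ fun e _ =>
      (fourier _).continuous.comp (continuous_apply e)
  have hint : ∀ {f : (ι → UnitAddCircle) → ℝ}, Continuous f → Integrable f μ := by
    intro f hf
    rw [← integrableOn_univ]
    exact hf.continuousOn.integrableOn_compact isCompact_univ
  have hcr : ∀ e, Continuous (r e) := by
    intro e
    have : r e = fun t => (symbol (g₀ e) t).re := by
      funext t; rw [hr, Complex.ofReal_re]
    rw [this]
    exact Complex.continuous_re.comp (continuous_symbol (ha₀ e))
  have h1 := sum_sub_eq_integral ha D B
  have h0 := sum_sub_eq_integral ha₀ D B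
  have h0' : (∑ x ∈ B, ∑ y ∈ B, ∏ e, g₀ e (D (x - y) e)) = ∫ t, (∏ e, r e (t e)) * S t ∂μ := by
    simp_rw [hr] at h0
    rw [← Complex.ofReal_inj, h0, ← integral_complex_ofReal]
    simp [S, μ]
  rw [h0', ← integral_const_mul]
  refine (le_abs_self _).trans ?_
  rw [← Real.norm_eq_abs, ← Complex.norm_real, h1]
  refine (norm_integral_le_integral_norm _).trans ?_
  refine integral_mono (hint ?_) (hint ?_) fun t => ?_
  · refine Continuous.norm (Continuous.mul ?_ (Complex.continuous_ofReal.comp hS))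
    exact continuous_finsetProd _ fun e _ => (continuous_symbol (ha e)).comp (continuous_apply e)
  · refine continuous_const.mul (Continuous.mul ?_ hS)
    exact continuous_finsetProd _ fun e _ => (hcr e).comp (continuous_apply e)
  · have hSt : 0 ≤ S t := sq_nonneg _
    simp only [norm_mul, norm_prod]
    rw [Complex.norm_real, Real.norm_of_nonneg (sq_nonneg _), ← mul_assoc,
      ← Finset.prod_mul_distrib]
    exact mul_le_mul_of_nonneg_right
      (Finset.prod_le_prod (fun e _ => norm_nonneg _) fun e _ => h e (t e)) hSt

/-! ### Gibbs measures on countable spaces -/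

section Gibbs

variable {α : Type*} {H : α → ℝ}

theorem tsum_ofReal_exp (hH : Summable fun x => Real.exp (-H x)) :
    ∑' x, ENNReal.ofReal (Real.exp (-H x)) = ENNReal.ofReal (∑' x, Real.exp (-H x)) :=
  (ENNReal.ofReal_tsum_of_nonneg (fun _ => (Real.exp_pos _).le) hH).symm

theorem tsum_exp_pos [Nonempty α] (hH : Summable fun x => Real.exp (-H x)) :
    0 < ∑' x, Real.exp (-H x) :=
  hH.tsum_pos (fun _ => (Real.exp_pos _).le) (Classical.arbitrary α) (Real.exp_pos _)

variable [MeasurableSpace α]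

theorem isProbabilityMeasure_gibbs [Nonempty α] (hH : Summable fun x => Real.exp (-H x)) :
    IsProbabilityMeasure (gibbs H) := by
  constructor
  simp only [gibbs, Measure.smul_apply, Measure.sum_apply _ MeasurableSet.univ, measure_univ,
    smul_eq_mul, mul_one]
  rw [tsum_ofReal_exp hH]
  refine ENNReal.inv_mul_cancel ?_ ENNReal.ofReal_ne_top
  exact (ENNReal.ofReal_pos.2 (tsum_exp_pos hH)).ne'

variable [Countable α] [MeasurableSingletonClass α]

theorem integral_gibbs {E : Type*} [NormedAddCommGroup E] [NormedSpace ℝ E]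
    [FiniteDimensional ℝ E] (hH : Summable fun x => Real.exp (-H x)) (f : α → E) :
    ∫ x, f x ∂gibbs H = (∑' x, Real.exp (-H x))⁻¹ • ∑' x, Real.exp (-H x) • f x := by
  rw [gibbs, integral_smul_measure, integral_sum_dirac fun _ => ENNReal.ofReal_ne_top,
    tsum_ofReal_exp hH, ENNReal.toReal_inv,
    ENNReal.toReal_ofReal (tsum_nonneg fun _ => (Real.exp_pos _).le)]
  simp_rw [ENNReal.toReal_ofReal (Real.exp_pos _).le]

theorem integrable_gibbs [Nonempty α] {E : Type*} [NormedAddCommGroup E]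
    (hH : Summable fun x => Real.exp (-H x))
    {f : α → E} (hf : Summable fun x => Real.exp (-H x) * ‖f x‖) :
    Integrable f (gibbs H) := by
  refine Integrable.smul_measure ?_ ?_
  · refine integrable_sum_dirac (fun _ => ENNReal.ofReal_ne_top) ?_
    simpa only [ENNReal.toReal_ofReal (Real.exp_pos _).le] using hf
  · rw [tsum_ofReal_exp hH]
    exact ENNReal.inv_ne_top.2 (ENNReal.ofReal_pos.2 (tsum_exp_pos hH)).ne'

end Gibbs

/-! ### Characteristic functions -/

/-- The coefficient of `x ^ 4` is wasteful so that the bound holds on the whole line: for `|x| ≥ 1`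
the right-hand side is already at least 1. -/
theorem cos_le_one_sub_add (x : ℝ) : Real.cos x ≤ 1 - x ^ 2 / 2 + x ^ 4 / 2 := by
  rcases le_total |x| 1 with h | h
  · have h1 := (abs_le.1 (Real.cos_bound h)).2
    have h2 : |x| ^ 4 = x ^ 4 := by rw [← abs_pow, abs_of_nonneg (by positivity)]
    rw [h2] at h1
    nlinarith [sq_nonneg (x ^ 2)]
  · have h1 : 1 ≤ x ^ 2 := by rw [← sq_abs]; nlinarith
    nlinarith [Real.cos_le_one x]

/-- A second order upper bound for the modulus of a characteristic function. -/
theorem norm_integral_cexp_le {Ω : Type*} [MeasurableSpace Ω] {μ : Measure Ω}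
    [IsProbabilityMeasure μ] {X : Ω → ℝ} (hX : Measurable X)
    (h4 : Integrable (fun ω => X ω ^ 4) μ) (τ : ℝ) :
    ‖∫ ω, Complex.exp (τ * X ω * Complex.I) ∂μ‖
      ≤ Real.exp (-(τ ^ 2 / 2 * Var[X; μ]) + 4 * τ ^ 4 * ∫ ω, X ω ^ 4 ∂μ) := by
  have hdom : ∀ f : Ω → ℝ, Measurable f → (∀ ω, |f ω| ≤ 1 + X ω ^ 4) → Integrable f μ := by
    intro f hf hb
    exact ((integrable_const (1 : ℝ)).add h4).mono' hf.aestronglyMeasurable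
      (Eventually.of_forall fun ω => by simpa using hb ω)
  have h2 : Integrable (fun ω => X ω ^ 2) μ := hdom _ (by fun_prop) fun ω => by
    rw [abs_of_nonneg (by positivity)]; nlinarith [sq_nonneg (X ω ^ 2 - 1)]
  have h1 : Integrable X μ := hdom _ hX fun ω => by
    rw [abs_le]
    constructor <;> nlinarith [sq_nonneg (X ω ^ 2 - 1), sq_nonneg (X ω - 1), sq_nonneg (X ω + 1)]
  have hc : Integrable (fun ω => Real.cos (τ * X ω)) μ := hdom _ (by fun_prop) fun ω =>
    (Real.abs_cos_le_one _).trans (by nlinarith [sq_nonneg (X ω ^ 2)])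
  have hs : Integrable (fun ω => Real.sin (τ * X ω)) μ := hdom _ (by fun_prop) fun ω =>
    (Real.abs_sin_le_one _).trans (by nlinarith [sq_nonneg (X ω ^ 2)])
  set c := ∫ ω, Real.cos (τ * X ω) ∂μ
  set s := ∫ ω, Real.sin (τ * X ω) ∂μ
  set m1 := ∫ ω, X ω ∂μ
  set m2 := ∫ ω, X ω ^ 2 ∂μ
  set m4 := ∫ ω, X ω ^ 4 ∂μ
  have hvar : Var[X; μ] = m2 - m1 ^ 2 := by
    rw [variance_eq_sub ((memLp_two_iff_integrable_sq hX.aestronglyMeasurable).2 h2)]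
    rfl
  have hnorm : ‖∫ ω, Complex.exp (τ * X ω * Complex.I) ∂μ‖ ^ 2 = c ^ 2 + s ^ 2 := by
    have : ∫ ω, Complex.exp (τ * X ω * Complex.I) ∂μ = c + s * Complex.I := by
      have e : ∀ ω, Complex.exp (τ * X ω * Complex.I)
          = ((Real.cos (τ * X ω) : ℝ) : ℂ) + ((Real.sin (τ * X ω) : ℝ) : ℂ) * Complex.I := by
        intro ω; rw [Complex.exp_mul_I]; push_cast; rfl
      simp_rw [e]
      rw [integral_add hc.ofReal (hs.ofReal.mul_const _), integral_mul_const,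
        integral_complex_ofReal, integral_complex_ofReal]
    rw [this, ← Complex.normSq_eq_norm_sq, Complex.normSq_add_mul_I]
  -- The left-hand side is the expectation of `cos (τ (X - y))`. Substituting `y = X ω` and
  -- integrating again gives `c² + s²`: this is symmetrisation by an independent copy, without a
  -- product space.
  have hy : ∀ y : ℝ, c * Real.cos (τ * y) + s * Real.sin (τ * y)
      ≤ 1 - τ ^ 2 / 2 * (m2 - 2 * y * m1 + y ^ 2) + 4 * τ ^ 4 * (m4 + y ^ 4) := by
    intro y
    have e1 : c * Real.cos (τ * y) + s * Real.sin (τ * y)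
        = ∫ ω, (Real.cos (τ * X ω) * Real.cos (τ * y) + Real.sin (τ * X ω) * Real.sin (τ * y)) ∂μ := by
      rw [integral_add (hc.mul_const _) (hs.mul_const _), integral_mul_const, integral_mul_const]
    have i1 : Integrable (fun ω => X ω ^ 2 - 2 * y * X ω) μ := h2.sub (h1.const_mul _)
    have i2 : Integrable (fun ω => X ω ^ 2 - 2 * y * X ω + y ^ 2) μ := i1.add (integrable_const _)
    have i3 : Integrable (fun ω => X ω ^ 4 + y ^ 4) μ := h4.add (integrable_const _)
    have i4 : Integrable (fun ω => 1 - τ ^ 2 / 2 * (X ω ^ 2 - 2 * y * X ω + y ^ 2)) μ :=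
      (integrable_const _).sub (i2.const_mul _)
    have e2 : 1 - τ ^ 2 / 2 * (m2 - 2 * y * m1 + y ^ 2) + 4 * τ ^ 4 * (m4 + y ^ 4)
        = ∫ ω, (1 - τ ^ 2 / 2 * (X ω ^ 2 - 2 * y * X ω + y ^ 2) + 4 * τ ^ 4 * (X ω ^ 4 + y ^ 4)) ∂μ := by
      rw [integral_add i4 (i3.const_mul _), integral_sub (integrable_const _) (i2.const_mul _),
        integral_const_mul, integral_const_mul, integral_add i1 (integrable_const _),
        integral_sub h2 (h1.const_mul _), integral_const_mul, integral_add h4 (integrable_const _)]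
      simp [m1, m2, m4]
    rw [e1, e2]
    refine integral_mono ((hc.mul_const _).add (hs.mul_const _)) (i4.add (i3.const_mul _))
      fun ω => ?_
    have h5 := cos_le_one_sub_add (τ * X ω - τ * y)
    rw [Real.cos_sub] at h5
    have h6 : (X ω - y) ^ 4 ≤ 8 * (X ω ^ 4 + y ^ 4) := by
      nlinarith [sq_nonneg (X ω ^ 2 - y ^ 2), sq_nonneg (X ω + y), sq_nonneg ((X ω + y) ^ 2),
        sq_nonneg (X ω * y), mul_nonneg (sq_nonneg (X ω + y)) (sq_nonneg (X ω - y)),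
        sq_nonneg ((X ω - y) ^ 2 - (X ω + y) ^ 2), sq_nonneg (X ω ^ 2 + y ^ 2)]
    have h7 : τ ^ 4 * (X ω - y) ^ 4 ≤ τ ^ 4 * (8 * (X ω ^ 4 + y ^ 4)) :=
      mul_le_mul_of_nonneg_left h6 (by positivity)
    simp only
    nlinarith
  have hfin : c ^ 2 + s ^ 2 ≤ 1 - τ ^ 2 * (m2 - m1 ^ 2) + 8 * τ ^ 4 * m4 := by
    have i1 : Integrable (fun ω => m2 - 2 * X ω * m1) μ :=
      (integrable_const _).sub ((h1.const_mul _).mul_const _)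
    have i2 : Integrable (fun ω => m2 - 2 * X ω * m1 + X ω ^ 2) μ := i1.add h2
    have i3 : Integrable (fun ω => m4 + X ω ^ 4) μ := (integrable_const _).add h4
    have i4 : Integrable (fun ω => 1 - τ ^ 2 / 2 * (m2 - 2 * X ω * m1 + X ω ^ 2)) μ :=
      (integrable_const _).sub (i2.const_mul _)
    have h5 := integral_mono ((hc.const_mul c).add (hs.const_mul s)) (i4.add (i3.const_mul _))
      (fun ω => hy (X ω))
    simp only [Pi.add_apply] at h5
    rw [integral_add (hc.const_mul _) (hs.const_mul _), integral_const_mul, integral_const_mul,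
      integral_add i4 (i3.const_mul _), integral_sub (integrable_const _) (i2.const_mul _),
      integral_const_mul, integral_const_mul, integral_add i1 h2,
      integral_sub (integrable_const _) ((h1.const_mul _).mul_const _), integral_mul_const,
      integral_const_mul, integral_add (integrable_const _) h4] at h5
    simp only [integral_const, probReal_univ, smul_eq_mul, one_mul] at h5
    have : c ^ 2 + s ^ 2 ≤ 1 - τ ^ 2 / 2 * (m2 - 2 * m1 * m1 + m2) + 4 * τ ^ 4 * (m4 + m4) := by
      rw [sq, sq]; exact h5
    nlinarith
  refine (pow_le_pow_iff_left₀ (norm_nonneg _) (Real.exp_pos _).le two_ne_zero).1 ?_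
  rw [hnorm, ← Real.exp_nat_mul, hvar]
  refine hfin.trans ?_
  refine le_trans (le_of_eq ?_) (Real.add_one_le_exp _)
  push_cast
  ring

/-! ### The integer-valued Gaussian -/

theorem summable_pow_mul_exp_neg_sq {c : ℝ} (hc : 0 < c) (j : ℕ) :
    Summable fun n : ℤ => |(n : ℝ)| ^ j * Real.exp (-(c * (n : ℝ) ^ 2)) := by
  have h := summable_pow_mul_jacobiTheta₂_term_bound 0 (div_pos hc Real.pi_pos) j
  refine h.congr fun n => ?_
  push_cast
  congr 2
  field_simp
  ring

theorem summable_exp_neg_sq_add {c : ℝ} (hc : 0 < c) (s : ℝ) :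
    Summable fun n : ℤ => Real.exp (s * n - c * (n : ℝ) ^ 2) := by
  have h := (summable_pow_mul_exp_neg_sq (half_pos hc) 0).mul_left (Real.exp (s ^ 2 / (2 * c)))
  refine Summable.of_nonneg_of_le (fun _ => (Real.exp_pos _).le) (fun n => ?_) h
  rw [pow_zero, one_mul, ← Real.exp_add]
  refine Real.exp_le_exp.2 ?_
  have : s ^ 2 / (2 * c) + -(c / 2 * (n : ℝ) ^ 2) - (s * n - c * (n : ℝ) ^ 2)
      = (s - c * n) ^ 2 / (2 * c) := by
    field_simp; ring
  have h2 : 0 ≤ (s - c * n) ^ 2 / (2 * c) := by positivity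
  linarith

/-- An integer lies at distance at least `|k| / 2` from a centre in `[0, 1/2]`. This supplies a
Gaussian majorant independent of the centre, hence the uniform moment bounds. -/
theorem sq_div_four_le {a : ℝ} (ha : a ∈ Set.Icc (0 : ℝ) (1 / 2)) (k : ℤ) :
    (k : ℝ) ^ 2 / 4 ≤ ((k : ℝ) - a) ^ 2 := by
  obtain ⟨h0, h1⟩ := ha
  rcases le_or_gt k 0 with hk | hk
  · have : (k : ℝ) ≤ 0 := by exact_mod_cast hk
    nlinarith
  · have : (1 : ℝ) ≤ k := by exact_mod_cast hk
    nlinarith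

section IntegerGaussian

variable {a b : ℝ}

theorem exp_integerGaussian_le (hb : 0 < b) (ha : a ∈ Set.Icc (0 : ℝ) (1 / 2)) (k : ℤ) :
    Real.exp (-(b / 2 * ((k : ℝ) - a) ^ 2)) ≤ Real.exp (-(b / 8 * (k : ℝ) ^ 2)) := by
  refine Real.exp_le_exp.2 ?_
  nlinarith [sq_div_four_le ha k]

theorem summable_pow_mul_integerGaussian (hb : 0 < b) (ha : a ∈ Set.Icc (0 : ℝ) (1 / 2))
    (j : ℕ) : Summable fun k : ℤ => Real.exp (-(b / 2 * ((k : ℝ) - a) ^ 2)) * |(k : ℝ)| ^ j := by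
  have h := summable_pow_mul_exp_neg_sq (c := b / 8) (by positivity) j
  refine Summable.of_nonneg_of_le (fun _ => by positivity) (fun k => ?_) h
  rw [mul_comm]
  exact mul_le_mul_of_nonneg_left (exp_integerGaussian_le hb ha k) (by positivity)

theorem summable_integerGaussian (hb : 0 < b) (ha : a ∈ Set.Icc (0 : ℝ) (1 / 2)) :
    Summable fun k : ℤ => Real.exp (-(b / 2 * ((k : ℝ) - a) ^ 2)) := by
  simpa using summable_pow_mul_integerGaussian hb ha 0

theorem isProbabilityMeasure_integerGaussian (hb : 0 < b) (ha : a ∈ Set.Icc (0 : ℝ) (1 / 2)) :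
    IsProbabilityMeasure (integerGaussian a b) :=
  isProbabilityMeasure_gibbs (summable_integerGaussian hb ha)

theorem integrable_pow_integerGaussian (hb : 0 < b) (ha : a ∈ Set.Icc (0 : ℝ) (1 / 2)) (j : ℕ) :
    Integrable (fun k : ℤ => (k : ℝ) ^ j) (integerGaussian a b) := by
  refine integrable_gibbs (summable_integerGaussian hb ha) ?_
  simpa using summable_pow_mul_integerGaussian hb ha j

theorem exp_neg_le_tsum_integerGaussian (hb : 0 < b) (ha : a ∈ Set.Icc (0 : ℝ) (1 / 2)) :
    Real.exp (-(b / 8)) ≤ ∑' k : ℤ, Real.exp (-(b / 2 * ((k : ℝ) - a) ^ 2)) := by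
  refine le_trans (Real.exp_le_exp.2 ?_)
    ((summable_integerGaussian hb ha).le_tsum 0 fun _ _ => (Real.exp_pos _).le)
  obtain ⟨h0, h1⟩ := ha
  have : a ^ 2 ≤ 1 / 4 := by nlinarith
  push_cast
  nlinarith

/-- The fourth moments are bounded uniformly in the centre. -/
theorem integral_pow_four_integerGaussian_le (hb : 0 < b) :
    ∃ K : ℝ, 0 ≤ K ∧ ∀ a ∈ Set.Icc (0 : ℝ) (1 / 2),
      ∫ k : ℤ, (k : ℝ) ^ 4 ∂integerGaussian a b ≤ K := by
  refine ⟨(Real.exp (-(b / 8)))⁻¹ * ∑' k : ℤ, |(k : ℝ)| ^ 4 * Real.exp (-(b / 8 * (k : ℝ) ^ 2)),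
    mul_nonneg (by positivity) (tsum_nonneg fun _ => by positivity), fun a ha => ?_⟩
  rw [integerGaussian, integral_gibbs (summable_integerGaussian hb ha), smul_eq_mul]
  have h4 : ∀ k : ℤ, (k : ℝ) ^ 4 = |(k : ℝ)| ^ 4 := fun k => by
    rw [← abs_pow, abs_of_nonneg (by positivity)]
  refine mul_le_mul ?_ ?_ (tsum_nonneg fun k => by rw [h4]; positivity) (by positivity)
  · exact inv_anti₀ (Real.exp_pos _) (exp_neg_le_tsum_integerGaussian hb ha)
  · refine Summable.tsum_le_tsum (fun k => ?_) ?_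
      (summable_pow_mul_exp_neg_sq (c := b / 8) (by positivity) 4)
    · rw [smul_eq_mul, mul_comm, h4]
      exact mul_le_mul_of_nonneg_left (exp_integerGaussian_le hb ha k) (by positivity)
    · simpa only [smul_eq_mul, h4] using summable_pow_mul_integerGaussian hb ha 4

/-- The variances are bounded below uniformly in the centre. -/
theorem exists_pos_le_varIG (hb : 0 < b) :
    ∃ c : ℝ, 0 < c ∧ ∀ a ∈ Set.Icc (0 : ℝ) (1 / 2), c ≤ varIG a b := by
  have hs := summable_pow_mul_exp_neg_sq (c := b / 8) (by positivity) 0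
  simp only [pow_zero, one_mul] at hs
  set Z := ∑' k : ℤ, Real.exp (-(b / 8 * (k : ℝ) ^ 2))
  have hZ : 0 < Z := tsum_exp_pos hs
  refine ⟨Z⁻¹ * (Real.exp (-(b / 2)) / 2), by positivity, fun a ha => ?_⟩
  have hP := isProbabilityMeasure_integerGaussian hb ha
  have hw := summable_integerGaussian hb ha
  have h1 := integrable_pow_integerGaussian hb ha 1
  have h2 := integrable_pow_integerGaussian hb ha 2
  simp only [pow_one] at h1
  rw [varIG, variance_eq_integral h1.aemeasurable]
  set m := ∫ k : ℤ, (k : ℝ) ∂integerGaussian a b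
  rw [integerGaussian, integral_gibbs hw, smul_eq_mul]
  have hZ' : 0 < ∑' k : ℤ, Real.exp (-(b / 2 * ((k : ℝ) - a) ^ 2)) := tsum_exp_pos hw
  have hsum : Summable fun k : ℤ =>
      Real.exp (-(b / 2 * ((k : ℝ) - a) ^ 2)) • ((k : ℝ) - m) ^ 2 := by
    have e0 := (summable_pow_mul_integerGaussian hb ha 2).mul_left 2
    have e1 := hw.mul_left (2 * m ^ 2)
    refine Summable.of_nonneg_of_le (fun _ => by positivity) (fun k => ?_) (e0.add e1)
    rw [sq_abs, smul_eq_mul]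
    have : ((k : ℝ) - m) ^ 2 ≤ 2 * (k : ℝ) ^ 2 + 2 * m ^ 2 := by nlinarith [sq_nonneg ((k : ℝ) + m)]
    nlinarith [mul_le_mul_of_nonneg_left this (Real.exp_pos (-(b / 2 * ((k : ℝ) - a) ^ 2))).le]
  refine mul_le_mul ?_ ?_ (by positivity) (by positivity)
  · exact inv_anti₀ hZ' (hw.tsum_le_tsum (exp_integerGaussian_le hb ha) hs)
  -- The atoms 0 and 1 suffice: both have weight at least `exp (-b/2)`, and `m² + (1 - m)² ≥ 1/2`
  -- for every mean `m`.
  · refine le_trans ?_ (hsum.sum_le_tsum {0, 1} fun _ _ => by positivity)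
    rw [Finset.sum_pair (by norm_num)]
    obtain ⟨ha0, ha1⟩ := ha
    have p0 : Real.exp (-(b / 2)) ≤ Real.exp (-(b / 2 * (((0 : ℤ) : ℝ) - a) ^ 2)) := by
      refine Real.exp_le_exp.2 ?_
      have : (((0 : ℤ) : ℝ) - a) ^ 2 ≤ 1 := by push_cast; nlinarith
      linarith [mul_le_mul_of_nonneg_left this (half_pos hb).le]
    have p1 : Real.exp (-(b / 2)) ≤ Real.exp (-(b / 2 * (((1 : ℤ) : ℝ) - a) ^ 2)) := by
      refine Real.exp_le_exp.2 ?_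
      have : (((1 : ℤ) : ℝ) - a) ^ 2 ≤ 1 := by push_cast; nlinarith
      linarith [mul_le_mul_of_nonneg_left this (half_pos hb).le]
    simp only [smul_eq_mul]
    have q0 := mul_le_mul_of_nonneg_right p0 (sq_nonneg (((0 : ℤ) : ℝ) - m))
    have q1 := mul_le_mul_of_nonneg_right p1 (sq_nonneg (((1 : ℤ) : ℝ) - m))
    refine le_trans ?_ (add_le_add q0 q1)
    rw [← mul_add, div_eq_mul_inv]
    refine mul_le_mul_of_nonneg_left ?_ (Real.exp_pos _).le
    push_cast
    nlinarith [sq_nonneg (2 * m - 1)]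

theorem bddBelow_varIG (b : ℝ) :
    BddBelow (Set.range fun a : Set.Icc (0 : ℝ) (1 / 2) => varIG a b) :=
  ⟨0, by rintro _ ⟨a, rfl⟩; exact variance_nonneg _ _⟩

theorem iInf_varIG_le (ha : a ∈ Set.Icc (0 : ℝ) (1 / 2)) :
    ⨅ a : Set.Icc (0 : ℝ) (1 / 2), varIG a b ≤ varIG a b :=
  ciInf_le (bddBelow_varIG b) ⟨a, ha⟩

theorem iInf_varIG_pos (hb : 0 < b) : 0 < ⨅ a : Set.Icc (0 : ℝ) (1 / 2), varIG a b := by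
  obtain ⟨c, hc, h⟩ := exists_pos_le_varIG hb
  have : Nonempty (Set.Icc (0 : ℝ) (1 / 2)) := ⟨⟨0, by norm_num⟩⟩
  exact hc.trans_le (le_ciInf fun a => h a a.2)

end IntegerGaussian

theorem errorM_pos {β : ℝ} (hβ : 0 < β) : 0 < errorM β := by
  have hb : 0 < (2 * Real.pi) ^ 2 * β := by positivity
  exact mul_pos hb (iInf_varIG_pos hb)

/-! ### Characteristic functions of integer-valued Gaussians, uniformly in the centre. -/

/-- The Fourier transform of the weights of the integer-valued Gaussian. -/
noncomputable def gaussianSeries (b a τ : ℝ) : ℂ :=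
  ∑' k : ℤ, (Real.exp (-(b / 2 * ((k : ℝ) - a) ^ 2)) : ℂ) * Complex.exp (τ * k * Complex.I)

theorem gaussianSeries_zero (b a : ℝ) :
    gaussianSeries b a 0 = ((∑' k : ℤ, Real.exp (-(b / 2 * ((k : ℝ) - a) ^ 2)) : ℝ) : ℂ) := by
  rw [gaussianSeries, Complex.ofReal_tsum]
  simp

/-- Shifting the summation index only produces a unimodular factor. Together with the reflection
below, this reduces every real centre to `[0, 1/2]`, the range of the infimum in `errorM`. -/
theorem norm_gaussianSeries_add_intCast (b a τ : ℝ) (m : ℤ) :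
    ‖gaussianSeries b (a + m) τ‖ = ‖gaussianSeries b a τ‖ := by
  have : gaussianSeries b (a + m) τ = Complex.exp (τ * m * Complex.I) * gaussianSeries b a τ := by
    rw [gaussianSeries, gaussianSeries, ← tsum_mul_left, ← (Equiv.addRight m).tsum_eq]
    refine tsum_congr fun k => ?_
    rw [Equiv.coe_addRight, mul_left_comm, ← Complex.exp_add]
    congr 3
    · congr 3
      push_cast; ring
    · push_cast; ring
  rw [this, norm_mul]
  have : (τ * m * Complex.I : ℂ) = ((τ * m : ℝ) : ℂ) * Complex.I := by push_cast; rfl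
  rw [this, Complex.norm_exp_ofReal_mul_I, one_mul]

theorem norm_gaussianSeries_neg (b a τ : ℝ) :
    ‖gaussianSeries b (-a) τ‖ = ‖gaussianSeries b a (-τ)‖ := by
  rw [gaussianSeries, gaussianSeries, ← (Equiv.neg ℤ).tsum_eq]
  congr 1
  refine tsum_congr fun k => ?_
  rw [Equiv.neg_apply, show ((-k : ℤ) : ℝ) - -a = -((k : ℝ) - a) by push_cast; ring, neg_sq]
  congr 2
  push_cast; ring

theorem norm_gaussianSeries_le_of_mem_Icc {b : ℝ} (hb : 0 < b) :
    ∃ K : ℝ, 0 ≤ K ∧ ∀ a ∈ Set.Icc (0 : ℝ) (1 / 2), ∀ τ : ℝ,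
      ‖gaussianSeries b a τ‖ ≤
        Real.exp (-(τ ^ 2 / 2 * ⨅ a : Set.Icc (0 : ℝ) (1 / 2), varIG a b) + K * τ ^ 4)
          * ‖gaussianSeries b a 0‖ := by
  obtain ⟨K, hK0, hK⟩ := integral_pow_four_integerGaussian_le hb
  refine ⟨4 * K, by positivity, fun a ha τ => ?_⟩
  have hP := isProbabilityMeasure_integerGaussian hb ha
  have hw := summable_integerGaussian hb ha
  have h := norm_integral_cexp_le (μ := integerGaussian a b) (X := fun k : ℤ => (k : ℝ))
    (measurable_of_countable _) (integrable_pow_integerGaussian hb ha 4) τ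
  have hZ := tsum_exp_pos hw
  rw [integerGaussian, integral_gibbs hw, norm_smul, norm_inv, Real.norm_of_nonneg hZ.le,
    inv_mul_le_iff₀ hZ, mul_comm] at h
  rw [gaussianSeries_zero, Complex.norm_real, Real.norm_of_nonneg hZ.le]
  have e : gaussianSeries b a τ = ∑' k : ℤ, Real.exp (-(b / 2 * ((k : ℝ) - a) ^ 2)) •
      Complex.exp (τ * ((k : ℝ) : ℂ) * Complex.I) := by
    rw [gaussianSeries]
    refine tsum_congr fun k => ?_
    rw [Complex.real_smul, Complex.ofReal_intCast]
  rw [e]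
  refine h.trans (mul_le_mul_of_nonneg_right (Real.exp_le_exp.2 ?_) hZ.le)
  have h1 : ⨅ a : Set.Icc (0 : ℝ) (1 / 2), varIG a b
      ≤ Var[fun k : ℤ => (k : ℝ); integerGaussian a b] := iInf_varIG_le ha
  have h2 := hK a ha
  have h3 : 0 ≤ τ ^ 2 / 2 := by positivity
  have h4 : 0 ≤ 4 * τ ^ 4 := by positivity
  have h5 := mul_le_mul_of_nonneg_left h1 h3
  have h6 := mul_le_mul_of_nonneg_left h2 h4
  rw [integerGaussian] at h5 h6
  linarith

theorem norm_gaussianSeries_le {b : ℝ} (hb : 0 < b) :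
    ∃ K : ℝ, 0 ≤ K ∧ ∀ a τ : ℝ, ‖gaussianSeries b a τ‖ ≤
        Real.exp (-(τ ^ 2 / 2 * ⨅ a : Set.Icc (0 : ℝ) (1 / 2), varIG a b) + K * τ ^ 4)
          * ‖gaussianSeries b a 0‖ := by
  obtain ⟨K, hK0, hK⟩ := norm_gaussianSeries_le_of_mem_Icc hb
  refine ⟨K, hK0, fun a τ => ?_⟩
  have ha : a = (a - round a) + (round a : ℤ) := by ring
  have hr := abs_le.1 (abs_sub_round a)
  rw [ha, norm_gaussianSeries_add_intCast, norm_gaussianSeries_add_intCast]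
  rcases le_total 0 (a - round a) with h | h
  · exact hK _ ⟨h, hr.2⟩ τ
  · have h1 := hK (-(a - round a)) ⟨by linarith, by linarith⟩ (-τ)
    rw [norm_gaussianSeries_neg, norm_gaussianSeries_neg, neg_neg, neg_zero] at h1
    simpa [Even.neg_pow (show Even 4 by decide)] using h1

/-! ### Tilted edge weights and their Fourier series. -/

/-- The edge weights of the tilted integer-valued Gaussian free field. -/
noncomputable def edgeWeight (β s : ℝ) (n : ℤ) : ℝ :=
  Real.exp (s * n - 1 / (2 * β) * (n : ℝ) ^ 2)

theorem summable_edgeWeight {β : ℝ} (hβ : 0 < β) (s : ℝ) : Summable (edgeWeight β s) :=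
  summable_exp_neg_sq_add (by positivity) s

theorem edgeWeight_pos (β s : ℝ) (n : ℤ) : 0 < edgeWeight β s n := Real.exp_pos _

/-- Poisson summation for the edge weights. -/
theorem symbol_edgeWeight {β : ℝ} (hβ : 0 < β) (s x : ℝ) :
    symbol (edgeWeight β s) (x : UnitAddCircle) =
      ((1 / (1 / (2 * Real.pi * β)) ^ (1 / 2 : ℝ) * Real.exp (β * s ^ 2 / 2) : ℝ) : ℂ)
        * (Complex.exp ((2 * Real.pi * β * s * x : ℝ) * Complex.I)
          * gaussianSeries ((2 * Real.pi) ^ 2 * β) x (-(2 * Real.pi * β * s))) := by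
  have hpi : (Real.pi : ℂ) ≠ 0 := by exact_mod_cast Real.pi_ne_zero
  have hβ' : (β : ℂ) ≠ 0 := by exact_mod_cast hβ.ne'
  have ha : 0 < 1 / (2 * Real.pi * β) := by positivity
  -- The tilt enters as the real part `s / (2π)` of a complex shift whose imaginary part is the
  -- Fourier variable `x`.
  have hP := Complex.tsum_exp_neg_quadratic (a := ((1 / (2 * Real.pi * β) : ℝ) : ℂ))
    (by rwa [Complex.ofReal_re]) (s / (2 * Real.pi) + x * Complex.I)
  have h1 : symbol (edgeWeight β s) (x : UnitAddCircle) =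
      ∑' n : ℤ, Complex.exp (-Real.pi * ((1 / (2 * Real.pi * β) : ℝ) : ℂ) * n ^ 2
        + 2 * Real.pi * (s / (2 * Real.pi) + x * Complex.I) * n) := by
    rw [symbol]
    refine tsum_congr fun n => ?_
    rw [edgeWeight, fourier_coe_apply, Complex.ofReal_exp, ← Complex.exp_add]
    congr 1
    push_cast
    field_simp
    ring
  have hc : ((1 / (1 / (2 * Real.pi * β)) ^ (1 / 2 : ℝ) : ℝ) : ℂ)
      = 1 / ((1 / (2 * Real.pi * β) : ℝ) : ℂ) ^ (1 / 2 : ℂ) := by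
    rw [Complex.ofReal_div, Complex.ofReal_one, Complex.ofReal_cpow ha.le]; norm_num
  rw [h1, hP, Complex.ofReal_mul, hc, mul_assoc (1 / _ : ℂ)]
  congr 1
  rw [gaussianSeries, ← tsum_mul_left, ← tsum_mul_left]
  refine tsum_congr fun k => ?_
  simp only [Complex.ofReal_exp, ← Complex.exp_add]
  congr 1
  push_cast
  have hI : Complex.I ^ 2 = -1 := Complex.I_sq
  field_simp
  ring_nf
  simp only [hI, Complex.I_pow_three, Complex.I_pow_four]
  ring

/-- Without a tilt the Poisson dual series has positive real terms and no phases. -/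
theorem symbol_edgeWeight_zero {β : ℝ} (hβ : 0 < β) (t : UnitAddCircle) :
    symbol (edgeWeight β 0) t = (‖symbol (edgeWeight β 0) t‖ : ℂ) := by
  induction t using QuotientAddGroup.induction_on with
  | H x =>
    have h : symbol (edgeWeight β 0) (x : UnitAddCircle)
        = ((1 / (1 / (2 * Real.pi * β)) ^ (1 / 2 : ℝ) * Real.exp (β * 0 ^ 2 / 2) *
          ∑' k : ℤ, Real.exp (-((2 * Real.pi) ^ 2 * β / 2 * ((k : ℝ) - x) ^ 2)) : ℝ) : ℂ) := by
      rw [symbol_edgeWeight hβ]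
      simp only [Complex.ofReal_mul, mul_zero, zero_mul, neg_zero, Complex.ofReal_zero, Complex.exp_zero, one_mul,
        gaussianSeries_zero]
    have h0 : 0 ≤ 1 / (1 / (2 * Real.pi * β)) ^ (1 / 2 : ℝ) * Real.exp (β * 0 ^ 2 / 2) *
          ∑' k : ℤ, Real.exp (-((2 * Real.pi) ^ 2 * β / 2 * ((k : ℝ) - x) ^ 2)) :=
      mul_nonneg (by positivity) (tsum_nonneg fun _ => (Real.exp_pos _).le)
    change symbol (edgeWeight β 0) (x : UnitAddCircle)
      = (‖symbol (edgeWeight β 0) (x : UnitAddCircle)‖ : ℂ)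
    rw [h, Complex.norm_real, Real.norm_of_nonneg h0]

/-- The gain comes from `τ = -2πβs`: then `τ² / 2` times the infimum of the variances is `β M(β) s²
/ 2`, which is subtracted from the Gaussian exponent `β s² / 2`. -/
theorem norm_symbol_edgeWeight_le {β : ℝ} (hβ : 0 < β) :
    ∃ K : ℝ, 0 ≤ K ∧ ∀ (s : ℝ) (t : UnitAddCircle), ‖symbol (edgeWeight β s) t‖ ≤
      Real.exp (β * (1 - errorM β) / 2 * s ^ 2 + K * s ^ 4) * ‖symbol (edgeWeight β 0) t‖ := by
  obtain ⟨K, hK0, hK⟩ := norm_gaussianSeries_le (b := (2 * Real.pi) ^ 2 * β) (by positivity)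
  refine ⟨K * (2 * Real.pi * β) ^ 4, by positivity, fun s t => ?_⟩
  induction t using QuotientAddGroup.induction_on with
  | H x =>
    have h0 : 0 ≤ 1 / (1 / (2 * Real.pi * β)) ^ (1 / 2 : ℝ) := by positivity
    have h := mul_le_mul_of_nonneg_left (hK x (-(2 * Real.pi * β * s)))
      (mul_nonneg h0 (Real.exp_pos (β * s ^ 2 / 2)).le)
    rw [symbol_edgeWeight hβ, symbol_edgeWeight hβ]
    simp only [norm_mul, Complex.norm_real, Complex.norm_exp_ofReal_mul_I, one_mul, mul_zero,
      neg_zero, Real.norm_of_nonneg h0, Real.norm_of_nonneg (Real.exp_pos _).le, ne_eq,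
      OfNat.ofNat_ne_zero, not_false_eq_true, zero_pow, zero_div, Real.exp_zero, mul_one]
    refine h.trans (le_of_eq ?_)
    have e : Real.exp (β * (1 - errorM β) / 2 * s ^ 2 + K * (2 * Real.pi * β) ^ 4 * s ^ 4)
        = Real.exp (β * s ^ 2 / 2) * Real.exp (-((-(2 * Real.pi * β * s)) ^ 2 / 2 *
          ⨅ a : Set.Icc (0 : ℝ) (1 / 2), varIG a ((2 * Real.pi) ^ 2 * β))
            + K * (-(2 * Real.pi * β * s)) ^ 4) := by
      rw [← Real.exp_add, errorM]
      congr 1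
      ring
    rw [e]
    ring

/-- Averaging the tilts `s` and `-s` shows that tilting never decreases the total mass, the value of
the symbol at 0. The bound on the symbols therefore has a nonnegative exponent; divide it by `s²`
and let `s → 0`. -/
theorem errorM_le_one {β : ℝ} (hβ : 0 < β) : errorM β ≤ 1 := by
  obtain ⟨K, hK0, hK⟩ := norm_symbol_edgeWeight_le hβ
  have hval : ∀ s, symbol (edgeWeight β s) 0 = ((∑' n, edgeWeight β s n : ℝ) : ℂ) := by
    intro s
    rw [symbol, Complex.ofReal_tsum]
    simp
  have hpos : 0 < ∑' n, edgeWeight β 0 n :=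
    (summable_edgeWeight hβ 0).tsum_pos (fun _ => (edgeWeight_pos _ _ _).le) 0
      (edgeWeight_pos _ _ _)
  have hmono : ∀ s, ∑' n, edgeWeight β 0 n ≤ ∑' n, edgeWeight β s n := by
    intro s
    have hneg : ∑' n, edgeWeight β (-s) n = ∑' n, edgeWeight β s n := by
      rw [← (Equiv.neg ℤ).tsum_eq]
      simp [edgeWeight]
    have hsum := (summable_edgeWeight hβ s).add (summable_edgeWeight hβ (-s))
    have h2 : ∑' n, 2 * edgeWeight β 0 n ≤ ∑' n, (edgeWeight β s n + edgeWeight β (-s) n) := by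
      refine Summable.tsum_le_tsum (fun n => ?_) ((summable_edgeWeight hβ 0).mul_left 2) hsum
      have e1 : ∀ s, edgeWeight β s n = edgeWeight β 0 n * Real.exp (s * n) := by
        intro s
        rw [edgeWeight, edgeWeight, ← Real.exp_add]
        congr 1
        ring
      rw [e1 s, e1 (-s)]
      have h3 := Real.add_one_le_exp (s * n)
      have h4 := Real.add_one_le_exp (-s * n)
      nlinarith [edgeWeight_pos β 0 n]
    rw [tsum_mul_left, (summable_edgeWeight hβ s).tsum_add (summable_edgeWeight hβ (-s)), hneg]
      at h2
    linarith
  have key : ∀ s : ℝ, 0 < s → 0 ≤ β * (1 - errorM β) / 2 + K * s ^ 2 := by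
    intro s hs
    have h := hK s 0
    rw [hval, hval, Complex.norm_real, Complex.norm_real, Real.norm_of_nonneg hpos.le,
      Real.norm_of_nonneg (hpos.le.trans (hmono s))] at h
    have h1 : 1 ≤ Real.exp (β * (1 - errorM β) / 2 * s ^ 2 + K * s ^ 4) := by
      by_contra! hlt
      nlinarith [hmono s]
    have h2 := Real.one_le_exp_iff.1 h1
    have h3 : 0 ≤ s ^ 2 * (β * (1 - errorM β) / 2 + K * s ^ 2) := by nlinarith
    exact nonneg_of_mul_nonneg_right h3 (by positivity)
  have hlim : Tendsto (fun s : ℝ => β * (1 - errorM β) / 2 + K * s ^ 2) (𝓝[>] 0)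
      (𝓝 (β * (1 - errorM β) / 2 + K * 0 ^ 2)) :=
    (Continuous.tendsto (by fun_prop) 0).mono_left nhdsWithin_le_nhds
  have := ge_of_tendsto hlim (eventually_mem_nhdsWithin.mono fun s hs => key s hs)
  by_contra! hlt
  nlinarith

/-! ### The radial flow

The flux of the planar vector field `z / |z| ^ 2` through the dual edges is a unit flow (up to the
factor `2π`) on `ℤ²`, with nearly optimal energy. -/

/-- The angle under which the segment from `(x + 1/2, y - 1/2)` to `(x + 1/2, y + 1/2)` is seen from
the origin. -/
noncomputable def angle (x y : ℤ) : ℝ :=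
  Real.arctan (((y : ℝ) + 1 / 2) / (x + 1 / 2)) - Real.arctan (((y : ℝ) - 1 / 2) / (x + 1 / 2))

theorem arctan_div_add_arctan_div {p q : ℝ} (hp : p ≠ 0) (hq : q ≠ 0) :
    Real.arctan (q / p) + Real.arctan (p / q)
      = Real.pi / 2 * ((if 0 < p then 1 else -1) * (if 0 < q then 1 else -1)) := by
  rw [← inv_div q p]
  rcases hp.lt_or_gt with hp | hp <;> rcases hq.lt_or_gt with hq | hq
  · rw [Real.arctan_inv_of_pos (div_pos_of_neg_of_neg hq hp), if_neg hp.not_gt, if_neg hq.not_gt]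
    ring
  · rw [Real.arctan_inv_of_neg (div_neg_of_pos_of_neg hq hp), if_neg hp.not_gt, if_pos hq]
    ring
  · rw [Real.arctan_inv_of_neg (div_neg_of_neg_of_pos hq hp), if_pos hp, if_neg hq.not_gt]
    ring
  · rw [Real.arctan_inv_of_pos (div_pos hq hp), if_pos hp, if_pos hq]
    ring

theorem intCast_add_half_ne_zero (x : ℤ) : (x : ℝ) + 1 / 2 ≠ 0 := by
  intro h
  have h1 : ((2 * x + 1 : ℤ) : ℝ) = 0 := by push_cast; linarith
  have h2 : 2 * x + 1 = 0 := by exact_mod_cast h1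
  omega

theorem intCast_sub_half_ne_zero (x : ℤ) : (x : ℝ) - 1 / 2 ≠ 0 := by
  have := intCast_add_half_ne_zero (x - 1)
  push_cast at this
  intro h
  exact this (by linarith)

theorem sign_add_half_sub_sign_sub_half (x : ℤ) :
    ((if 0 < (x : ℝ) + 1 / 2 then 1 else -1) - (if 0 < (x : ℝ) - 1 / 2 then 1 else -1) : ℝ)
      = if x = 0 then 2 else 0 := by
  rcases lt_trichotomy x 0 with h | h | h
  · have : (x : ℝ) ≤ -1 := by exact_mod_cast Int.le_sub_one_of_lt h
    rw [if_neg (by linarith), if_neg (by linarith), if_neg h.ne]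
    norm_num
  · subst h; norm_num
  · have : (1 : ℝ) ≤ x := by exact_mod_cast h
    rw [if_pos (by linarith), if_pos (by linarith), if_neg h.ne']
    norm_num

/-- The four signed angles of the sides of a unit cell add up to the full angle if the cell contains
the origin and to zero otherwise. The identity `arctan z + arctan z⁻¹ = ±π/2` at the four corners
reduces this to signs. -/
theorem angle_divergence (x y : ℤ) :
    angle x y - angle (x - 1) y + (angle y x - angle (y - 1) x)
      = if (x, y) = (0, 0) then 2 * Real.pi else 0 := by
  have hp := intCast_add_half_ne_zero x
  have hp' := intCast_sub_half_ne_zero x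
  have hq := intCast_add_half_ne_zero y
  have hq' := intCast_sub_half_ne_zero y
  have h1 := arctan_div_add_arctan_div hp hq
  have h2 := arctan_div_add_arctan_div hp hq'
  have h3 := arctan_div_add_arctan_div hp' hq
  have h4 := arctan_div_add_arctan_div hp' hq'
  have ex : ((x - 1 : ℤ) : ℝ) + 1 / 2 = x - 1 / 2 := by push_cast; ring
  have ey : ((y - 1 : ℤ) : ℝ) + 1 / 2 = y - 1 / 2 := by push_cast; ring
  have hx := sign_add_half_sub_sign_sub_half x
  have hy := sign_add_half_sub_sign_sub_half y
  have key : angle x y - angle (x - 1) y + (angle y x - angle (y - 1) x)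
      = Real.pi / 2 * ((if x = 0 then 2 else 0) * (if y = 0 then 2 else 0)) := by
    rw [← hx, ← hy]
    simp only [angle, ex, ey]
    linear_combination h1 - h2 - h3 + h4
  rw [key]
  simp only [Prod.mk.injEq]
  by_cases h : x = 0 <;> by_cases h' : y = 0 <;> simp [h, h']; ring

theorem angle_neg_sub_one (x y : ℤ) : angle (-1 - x) y = -angle x y := by
  have : ((-1 - x : ℤ) : ℝ) + 1 / 2 = -((x : ℝ) + 1 / 2) := by push_cast; ring
  rw [angle, angle, this, div_neg, div_neg, Real.arctan_neg, Real.arctan_neg]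
  ring

theorem angle_neg_right (x y : ℤ) : angle x (-y) = angle x y := by
  have h1 : ((-y : ℤ) : ℝ) + 1 / 2 = -((y : ℝ) - 1 / 2) := by push_cast; ring
  have h2 : ((-y : ℤ) : ℝ) - 1 / 2 = -((y : ℝ) + 1 / 2) := by push_cast; ring
  rw [angle, angle, h1, h2, neg_div, neg_div, Real.arctan_neg, Real.arctan_neg]
  ring

theorem angle_nonneg {x : ℤ} (hx : 0 ≤ x) (y : ℤ) : 0 ≤ angle x y := by
  have : (0 : ℝ) ≤ x := by exact_mod_cast hx
  refine sub_nonneg.2 (Real.arctan_strictMono.monotone ?_)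
  gcongr
  linarith

theorem arctan_le_self {z : ℝ} (hz : 0 ≤ z) : Real.arctan z ≤ z := by
  have h := Real.le_tan (Real.arctan_nonneg.2 hz) (Real.arctan_lt_pi_div_two z)
  rwa [Real.tan_arctan] at h

/-- The right-hand side is the tangent of the angle, by the addition formula. The second hypothesis
excludes only the edge at the origin, whose angle is `π / 2`. -/
theorem angle_le {x y : ℤ} (hx : 0 ≤ x) (h : 0 < x ^ 2 + x + y ^ 2) :
    angle x y ≤ ((x : ℝ) + 1 / 2) / ((x : ℝ) ^ 2 + x + (y : ℝ) ^ 2) := by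
  have hx' : (0 : ℝ) ≤ x := by exact_mod_cast hx
  have h' : (0 : ℝ) < (x : ℝ) ^ 2 + x + (y : ℝ) ^ 2 := by exact_mod_cast h
  have hX : (0 : ℝ) < x + 1 / 2 := by linarith
  have e1 : 1 - ((y : ℝ) + 1 / 2) / (x + 1 / 2) * (-(((y : ℝ) - 1 / 2) / (x + 1 / 2)))
      = ((x : ℝ) ^ 2 + x + (y : ℝ) ^ 2) / ((x : ℝ) + 1 / 2) ^ 2 := by
    field_simp; ring
  have hpos : 0 < ((x : ℝ) ^ 2 + x + (y : ℝ) ^ 2) / ((x : ℝ) + 1 / 2) ^ 2 := by positivity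
  rw [angle, sub_eq_add_neg, ← Real.arctan_neg, Real.arctan_add (by linarith), e1]
  have e2 : (((y : ℝ) + 1 / 2) / (x + 1 / 2) + -(((y : ℝ) - 1 / 2) / (x + 1 / 2)))
      / (((x : ℝ) ^ 2 + x + (y : ℝ) ^ 2) / ((x : ℝ) + 1 / 2) ^ 2)
      = ((x : ℝ) + 1 / 2) / ((x : ℝ) ^ 2 + x + (y : ℝ) ^ 2) := by
    field_simp; ring
  rw [e2]
  exact arctan_le_self (by positivity)

/-! ### Energy estimates for the radial flow. -/

theorem sum_Icc_neg_eq (f : ℤ → ℝ) (R : ℕ) :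
    ∑ y ∈ Finset.Icc (-(R : ℤ)) R, f y
      = f 0 + ∑ i ∈ Finset.range R, (f (i + 1) + f (-(i + 1))) := by
  induction R with
  | zero => simp
  | succ R ih =>
    have h : Finset.Icc (-((R + 1 : ℕ) : ℤ)) ((R + 1 : ℕ) : ℤ)
        = insert ((R : ℤ) + 1) (insert (-((R : ℤ) + 1)) (Finset.Icc (-(R : ℤ)) R)) := by
      ext z
      simp only [Finset.mem_Icc, Finset.mem_insert]
      omega
    rw [h, Finset.sum_insert, Finset.sum_insert, ih, Finset.sum_range_succ]
    · ring
    · simp only [Finset.mem_Icc]; omega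
    · simp only [Finset.mem_insert, Finset.mem_Icc]; omega

theorem sum_range_inv_sq_le (R : ℕ) :
    ∑ i ∈ Finset.range R, 1 / ((i : ℝ) + 1) ^ 2 ≤ 2 := by
  have h : ∀ R : ℕ, ∑ i ∈ Finset.range (R + 1), 1 / ((i : ℝ) + 1) ^ 2 ≤ 2 - 1 / ((R : ℝ) + 1) := by
    intro R
    induction R with
    | zero => norm_num
    | succ R ih =>
      rw [Finset.sum_range_succ]
      have h0 : (0 : ℝ) ≤ R := R.cast_nonneg
      have h1 : 1 / ((R : ℝ) + 1 + 1) ^ 2 ≤ 1 / (((R : ℝ) + 1) * (R + 1 + 1)) :=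
        one_div_le_one_div_of_le (by positivity) (by nlinarith)
      have h2 : 1 / (((R : ℝ) + 1) * (R + 1 + 1)) = 1 / ((R : ℝ) + 1) - 1 / ((R : ℝ) + 1 + 1) := by
        field_simp; ring
      push_cast
      linarith
  rcases R with _ | R
  · simp
  · have : 0 ≤ 1 / ((R : ℝ) + 1) := by positivity
    linarith [h R]

theorem sum_range_inv_le (R : ℕ) :
    ∑ i ∈ Finset.range R, 1 / ((i : ℝ) + 1) ≤ 1 + Real.log R := by
  have h := harmonic_le_one_add_log R
  rw [harmonic] at h
  push_cast at h
  simpa using h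

theorem sum_range_inv_sq_add_sq_le {c : ℝ} (hc : 0 < c) (R : ℕ) :
    ∑ i ∈ Finset.range R, 1 / (c ^ 2 + ((i : ℝ) + 1) ^ 2) ^ 2 ≤ Real.pi / (4 * c ^ 3) := by
  -- An antiderivative of `1 / (c² + t²)²`. The integrand decreases on `t ≥ 0`, so the sum is at
  -- most the integral over the half-line, which is `π / (4c³)`.
  set H : ℝ → ℝ := fun t => t / (2 * c ^ 2 * (c ^ 2 + t ^ 2)) + Real.arctan (t / c) / (2 * c ^ 3)
  have hH : ∀ t, HasDerivAt H (1 / (c ^ 2 + t ^ 2) ^ 2) t := by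
    intro t
    have hd : 2 * c ^ 2 * (c ^ 2 + t ^ 2) ≠ 0 := by positivity
    have h1 : HasDerivAt (fun t : ℝ => 2 * c ^ 2 * (c ^ 2 + t ^ 2)) (2 * c ^ 2 * (2 * t)) t := by
      simpa using (((hasDerivAt_id t).pow 2).const_add (c ^ 2)).const_mul (2 * c ^ 2)
    have h2 := (hasDerivAt_id t).div h1 hd
    have h3 := (((hasDerivAt_id t).div_const c).arctan).div_const (2 * c ^ 3)
    refine (h2.add h3).congr_deriv ?_
    have : c ^ 2 + t ^ 2 ≠ 0 := by positivity
    simp only [id]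
    have e : 1 + (t / c) ^ 2 = (c ^ 2 + t ^ 2) / c ^ 2 := by field_simp
    rw [e]
    field_simp
    ring
  have hstep : ∀ i : ℕ, 1 / (c ^ 2 + ((i : ℝ) + 1) ^ 2) ^ 2 ≤ H ((i + 1 : ℕ) : ℝ) - H i := by
    intro i
    obtain ⟨ξ, hξ, he⟩ := exists_hasDerivAt_eq_slope H (fun t => 1 / (c ^ 2 + t ^ 2) ^ 2)
      (show (i : ℝ) < ((i + 1 : ℕ) : ℝ) by push_cast; linarith)
      (fun t _ => (hH t).continuousAt.continuousWithinAt) (fun t _ => hH t)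
    have e1 : (((i + 1 : ℕ) : ℝ) - i) = 1 := by push_cast; ring
    rw [e1, div_one] at he
    rw [← he]
    have h0 : (0 : ℝ) ≤ i := i.cast_nonneg
    have h1 := hξ.1
    have h2 := hξ.2
    push_cast at h2
    have hξ0 : 0 ≤ ξ := by linarith
    gcongr
  have hsum : ∑ i ∈ Finset.range R, 1 / (c ^ 2 + ((i : ℝ) + 1) ^ 2) ^ 2 ≤ H R := by
    refine (Finset.sum_le_sum fun i _ => hstep i).trans ?_
    rw [Finset.sum_range_sub (fun i : ℕ => H i)]
    simp [H]
  refine hsum.trans ?_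
  rcases R.eq_zero_or_pos with rfl | hR
  · simp [H]; positivity
  · have hR' : (0 : ℝ) < R := by exact_mod_cast hR
    have h1 := Real.arctan_inv_of_pos (div_pos hR' hc)
    rw [inv_div] at h1
    set z := c / (R : ℝ)
    have hz : 0 < z := div_pos hc hR'
    -- This is `sin (2θ) ≤ 2θ` at `θ = arctan z`.
    have h2 : z / (1 + z ^ 2) ≤ Real.arctan z := by
      have h3 : Real.sin (2 * Real.arctan z) ≤ 2 * Real.arctan z :=
        Real.sin_le (by have := Real.arctan_nonneg.2 hz.le; linarith)
      rw [Real.sin_two_mul, Real.sin_arctan, Real.cos_arctan] at h3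
      have h4 : 2 * (z / √(1 + z ^ 2)) * (1 / √(1 + z ^ 2)) = 2 * (z / (1 + z ^ 2)) := by
        rw [mul_assoc, div_mul_div_comm, Real.mul_self_sqrt (by positivity), mul_one]
      linarith
    have h5 : H R = (z / (1 + z ^ 2) + Real.arctan (R / c)) / (2 * c ^ 3) := by
      simp only [H, z]
      field_simp
      ring
    rw [h5, div_le_div_iff₀ (by positivity) (by positivity)]
    have h6 : z / (1 + z ^ 2) + Real.arctan (R / c) ≤ Real.pi / 2 := by linarith
    nlinarith [pow_pos hc 3]

/-- The energy of the flow through a column. -/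
noncomputable def columnEnergy (R : ℕ) (x : ℤ) : ℝ :=
  ∑ y ∈ Finset.Icc (-(R : ℤ)) R, angle x y ^ 2

theorem columnEnergy_eq (R : ℕ) (x : ℤ) :
    columnEnergy R x = angle x 0 ^ 2 + 2 * ∑ i ∈ Finset.range R, angle x (i + 1) ^ 2 := by
  rw [columnEnergy, sum_Icc_neg_eq, Finset.mul_sum]
  congr 1
  refine Finset.sum_congr rfl fun i _ => ?_
  rw [angle_neg_right]
  ring

/-- The leading constant `π / 2` must be sharp. The two half-planes turn it into `π log R`, and the
two edge directions together with the normalisation `(2π)⁻²` into `log R / (2π)`. The remaining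
terms are summable over the columns. -/
theorem columnEnergy_le (R i : ℕ) :
    columnEnergy R ((i : ℤ) + 1) ≤ Real.pi / 2 * (1 / ((i : ℝ) + 1)) + 2 * (1 / ((i : ℝ) + 1) ^ 2) := by
  set x : ℝ := (i : ℝ) + 1
  have hx : 1 ≤ x := by simp [x]
  have hx0 : 0 < x := by linarith
  set c := √(x ^ 2 + x)
  have hc2 : c ^ 2 = x ^ 2 + x := Real.sq_sqrt (by positivity)
  have hcx : x ≤ c := Real.le_sqrt_of_sq_le (by linarith)
  have hc : 0 < c := by linarith
  have hang : ∀ y : ℤ, angle ((i : ℤ) + 1) y ^ 2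
      ≤ (x + 1 / 2) ^ 2 * (1 / (c ^ 2 + (y : ℝ) ^ 2) ^ 2) := by
    intro y
    have h1 := angle_le (x := (i : ℤ) + 1) (y := y) (by positivity) (by positivity)
    have h0 := angle_nonneg (x := (i : ℤ) + 1) (by positivity) y
    push_cast at h1
    rw [hc2, mul_one_div, ← div_pow]
    exact pow_le_pow_left₀ h0 h1 2
  have h0 := hang 0
  have hs : ∑ j ∈ Finset.range R, angle ((i : ℤ) + 1) (j + 1) ^ 2
      ≤ (x + 1 / 2) ^ 2 * (Real.pi / (4 * c ^ 3)) := by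
    refine le_trans (Finset.sum_le_sum fun j _ => hang _) ?_
    rw [← Finset.mul_sum]
    refine mul_le_mul_of_nonneg_left ?_ (by positivity)
    have := sum_range_inv_sq_add_sq_le hc R
    push_cast
    exact this
  rw [columnEnergy_eq]
  have hX : (x + 1 / 2) ^ 2 = c ^ 2 + 1 / 4 := by rw [hc2]; ring
  have e1 : (x + 1 / 2) ^ 2 * (1 / (c ^ 2 + ((0 : ℤ) : ℝ) ^ 2) ^ 2)
      = 1 / c ^ 2 + 1 / 4 * (1 / c ^ 4) := by
    rw [hX]; push_cast; field_simp; ring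
  have e2 : 2 * ((x + 1 / 2) ^ 2 * (Real.pi / (4 * c ^ 3)))
      = Real.pi / 2 * (1 / c) + Real.pi / 8 * (1 / c ^ 3) := by
    rw [hX]; field_simp; ring
  have b1 : 1 / c ≤ 1 / x := one_div_le_one_div_of_le hx0 hcx
  have b2 : 1 / c ^ 2 ≤ 1 / x ^ 2 := one_div_le_one_div_of_le (by positivity) (by gcongr)
  have b3 : 1 / c ^ 3 ≤ 1 / x ^ 2 :=
    one_div_le_one_div_of_le (by positivity)
      ((pow_le_pow_left₀ hx0.le hcx 2).trans (pow_le_pow_right₀ (hx.trans hcx) (by norm_num)))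
  have b4 : 1 / c ^ 4 ≤ 1 / x ^ 2 :=
    one_div_le_one_div_of_le (by positivity)
      ((pow_le_pow_left₀ hx0.le hcx 2).trans (pow_le_pow_right₀ (hx.trans hcx) (by norm_num)))
  have hpi := Real.pi_pos
  have hpi4 := Real.pi_lt_four
  have hq : 0 ≤ 1 / x ^ 2 := by positivity
  have b5 := mul_le_mul_of_nonneg_left b1 (by positivity : 0 ≤ Real.pi / 2)
  have b6 := mul_le_mul_of_nonneg_left b3 (by positivity : 0 ≤ Real.pi / 8)
  have b7 : Real.pi / 8 * (1 / x ^ 2) ≤ 1 / 2 * (1 / x ^ 2) :=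
    mul_le_mul_of_nonneg_right (by linarith) hq
  linarith

theorem angle_zero_zero : angle 0 0 = Real.pi / 2 := by
  rw [angle]
  have h1 : (((0 : ℤ) : ℝ) + 1 / 2) / (((0 : ℤ) : ℝ) + 1 / 2) = 1 := by norm_num
  have h2 : (((0 : ℤ) : ℝ) - 1 / 2) / (((0 : ℤ) : ℝ) + 1 / 2) = -1 := by norm_num
  rw [h1, h2, Real.arctan_neg, Real.arctan_one]
  ring

theorem angle_zero_add_one_le (i : ℕ) : angle 0 ((i : ℤ) + 1) ≤ 1 / ((i : ℝ) + 1) ^ 2 := by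
  have h := angle_le (x := 0) (y := (i : ℤ) + 1) le_rfl (by positivity)
  push_cast at h
  refine h.trans ?_
  have : (0 : ℝ) ^ 2 + 0 + ((i : ℝ) + 1) ^ 2 = ((i : ℝ) + 1) ^ 2 := by ring
  rw [this]
  gcongr
  norm_num

theorem columnEnergy_zero_le (R : ℕ) : columnEnergy R 0 ≤ 8 := by
  rw [columnEnergy_eq, angle_zero_zero]
  have h : ∑ i ∈ Finset.range R, angle 0 (i + 1) ^ 2 ≤ 2 := by
    refine le_trans (Finset.sum_le_sum fun i _ => ?_) (sum_range_inv_sq_le R)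
    have h1 := angle_zero_add_one_le i
    have h0 := angle_nonneg le_rfl ((i : ℤ) + 1)
    have h2 : 1 / ((i : ℝ) + 1) ^ 2 ≤ 1 := by
      rw [div_le_one (by positivity)]
      have : (0 : ℝ) ≤ i := i.cast_nonneg
      nlinarith
    nlinarith
  nlinarith [Real.pi_lt_four, Real.pi_pos]

theorem columnEnergy_neg_sub_one (R : ℕ) (x : ℤ) : columnEnergy R (-1 - x) = columnEnergy R x := by
  refine Finset.sum_congr rfl fun y _ => ?_
  rw [angle_neg_sub_one, neg_sq]

/-- An even function about `-1/2` has sum at most twice the sum over the right half. -/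
theorem sum_Icc_le_two_mul_of_symm {F : ℤ → ℝ} (hF : ∀ x, F (-1 - x) = F x) (hF0 : ∀ x, 0 ≤ F x)
    (R : ℕ) : ∑ x ∈ Finset.Icc (-(R : ℤ)) R, F x
      ≤ 2 * F 0 + 2 * ∑ i ∈ Finset.range R, F (i + 1) := by
  rw [sum_Icc_neg_eq, Finset.sum_add_distrib]
  have h1 : ∑ i ∈ Finset.range R, F (-(i + 1)) = ∑ i ∈ Finset.range R, F (i : ℤ) := by
    refine Finset.sum_congr rfl fun i _ => ?_
    rw [← hF]; congr 1; ring
  have h2 : ∑ i ∈ Finset.range R, F (i : ℤ) ≤ ∑ i ∈ Finset.range (R + 1), F (i : ℤ) :=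
    Finset.sum_le_sum_of_subset_of_nonneg (Finset.range_subset_range.2 R.le_succ)
      fun i _ _ => hF0 _
  rw [Finset.sum_range_succ'] at h2
  push_cast at h2
  rw [h1]
  linarith

theorem sum_box_angle_sq_le (R : ℕ) :
    ∑ w ∈ box R, angle w.1 w.2 ^ 2 ≤ Real.pi * Real.log R + 28 := by
  rw [box, Finset.sum_product]
  refine (sum_Icc_le_two_mul_of_symm (F := columnEnergy R) (columnEnergy_neg_sub_one R)
    (fun x => Finset.sum_nonneg fun y _ => sq_nonneg _) R).trans ?_
  have h := Finset.sum_le_sum fun i (_ : i ∈ Finset.range R) => columnEnergy_le R i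
  rw [Finset.sum_add_distrib, ← Finset.mul_sum, ← Finset.mul_sum] at h
  have h0 := columnEnergy_zero_le R
  have h1 := mul_le_mul_of_nonneg_left (sum_range_inv_le R)
    (by positivity : 0 ≤ Real.pi / 2)
  have h2 := sum_range_inv_sq_le R
  have h3 := Real.pi_lt_four
  linarith

theorem angle_sq_le_of_pos (i : ℕ) (y : ℤ) :
    angle ((i : ℤ) + 1) y ^ 2 ≤ 9 / 4 * (1 / ((i : ℝ) + 1) ^ 2) := by
  have h1 := angle_le (x := (i : ℤ) + 1) (y := y) (by positivity) (by positivity)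
  have h0 := angle_nonneg (x := (i : ℤ) + 1) (by positivity) y
  push_cast at h1
  have hi : (0 : ℝ) ≤ i := i.cast_nonneg
  have h2 : ((i : ℝ) + 1 + 1 / 2) / (((i : ℝ) + 1) ^ 2 + (i + 1) + (y : ℝ) ^ 2)
      ≤ 3 / 2 * (1 / ((i : ℝ) + 1)) := by
    rw [mul_one_div, div_le_div_iff₀ (by positivity) (by positivity)]
    nlinarith [sq_nonneg (y : ℝ)]
  have h3 := pow_le_pow_left₀ h0 (h1.trans h2) 2
  refine h3.trans (le_of_eq ?_)
  rw [mul_pow, div_pow, div_pow, one_pow]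
  norm_num

theorem angle_zero_sq_le (y : ℤ) : angle 0 y ^ 2 ≤ 4 := by
  have h0 := angle_nonneg le_rfl y
  have h1 : angle 0 y ≤ 2 := by
    rcases eq_or_ne y 0 with rfl | hy
    · rw [angle_zero_zero]; linarith [Real.pi_lt_four]
    · have hy2 : 0 < y ^ 2 := by positivity
      have h := angle_le (x := 0) (y := y) le_rfl (by simpa using hy2)
      refine h.trans ?_
      have : (1 : ℝ) ≤ (y : ℝ) ^ 2 := by exact_mod_cast hy2
      push_cast
      rw [div_le_iff₀ (by nlinarith)]
      nlinarith
  nlinarith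

theorem sum_box_angle_pow_four_le (R : ℕ) :
    ∑ w ∈ box R, angle w.1 w.2 ^ 4 ≤ 200 := by
  rw [box, Finset.sum_product]
  set F : ℤ → ℝ := fun x => ∑ y ∈ Finset.Icc (-(R : ℤ)) R, angle x y ^ 4
  have hsplit : ∀ x y, angle x y ^ 4 = angle x y ^ 2 * angle x y ^ 2 := fun x y => by ring
  have hF0 : F 0 ≤ 32 := by
    have : F 0 ≤ 4 * columnEnergy R 0 := by
      rw [columnEnergy, Finset.mul_sum]
      refine Finset.sum_le_sum fun y _ => ?_
      rw [hsplit]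
      exact mul_le_mul_of_nonneg_right (angle_zero_sq_le y) (sq_nonneg _)
    linarith [columnEnergy_zero_le R]
  have hF : ∀ i : ℕ, F ((i : ℤ) + 1) ≤ 9 * (1 / ((i : ℝ) + 1) ^ 2) := by
    intro i
    have h1 : F ((i : ℤ) + 1)
        ≤ 9 / 4 * (1 / ((i : ℝ) + 1) ^ 2) * columnEnergy R ((i : ℤ) + 1) := by
      rw [columnEnergy, Finset.mul_sum]
      refine Finset.sum_le_sum fun y _ => ?_
      rw [hsplit]
      exact mul_le_mul_of_nonneg_right (angle_sq_le_of_pos i y) (sq_nonneg _)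
    have hx : (1 : ℝ) ≤ (i : ℝ) + 1 := by simp
    have h2 : columnEnergy R ((i : ℤ) + 1) ≤ 4 := by
      refine (columnEnergy_le R i).trans ?_
      have e1 : 1 / ((i : ℝ) + 1) ≤ 1 := by rw [div_le_one (by linarith)]; exact hx
      have e2 : 1 / ((i : ℝ) + 1) ^ 2 ≤ 1 := by
        rw [div_le_one (by positivity)]; exact one_le_pow₀ hx
      have e3 := mul_le_mul_of_nonneg_left e1 (by positivity : 0 ≤ Real.pi / 2)
      linarith [Real.pi_lt_four]
    refine h1.trans ?_
    have := mul_le_mul_of_nonneg_left h2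
      (by positivity : 0 ≤ 9 / 4 * (1 / ((i : ℝ) + 1) ^ 2))
    linarith
  refine (sum_Icc_le_two_mul_of_symm (F := F) (fun x => ?_)
    (fun x => Finset.sum_nonneg fun y _ => by positivity) R).trans ?_
  · refine Finset.sum_congr rfl fun y _ => ?_
    rw [angle_neg_sub_one, Even.neg_pow (by decide)]
  · have h := Finset.sum_le_sum fun i (_ : i ∈ Finset.range R) => hF i
    rw [← Finset.mul_sum] at h
    linarith [sum_range_inv_sq_le R]

/-! ### Discrete calculus on `ℤ²` -/

theorem mem_box {n : ℕ} {w : ℤ × ℤ} :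
    w ∈ box n ↔ (-(n : ℤ) ≤ w.1 ∧ w.1 ≤ n) ∧ (-(n : ℤ) ≤ w.2 ∧ w.2 ≤ n) := by
  simp [box]

/-- The integer-valued extension by zero. -/
noncomputable def extendZeroInt {n : ℕ} (Ψ : box n → ℤ) (w : ℤ × ℤ) : ℤ :=
  if h : w ∈ box n then Ψ ⟨w, h⟩ else 0

theorem extendZero_eq_intCast {n : ℕ} (Ψ : box n → ℤ) (w : ℤ × ℤ) :
    extendZero Ψ w = (extendZeroInt Ψ w : ℝ) := by
  unfold extendZero extendZeroInt
  split_ifs <;> simp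

theorem extendZero_coe {n : ℕ} (Ψ : box n → ℤ) (v : box n) : extendZero Ψ v = Ψ v := by
  simp [extendZero]

theorem extendZero_of_notMem {n : ℕ} (Ψ : box n → ℤ) {w : ℤ × ℤ} (h : w ∉ box n) :
    extendZero Ψ w = 0 := by
  simp [extendZero, h]

/-- The two lattice directions. -/
def dir : Bool → ℤ × ℤ
  | false => (1, 0)
  | true => (0, 1)

theorem add_dir_notMem {n : ℕ} {w : ℤ × ℤ} (h : w ∉ box (n + 1)) (i : Bool) :
    w + dir i ∉ box n := by
  rw [mem_box] at h ⊢
  cases i <;> simp only [dir, Prod.fst_add, Prod.snd_add] <;> push_cast at h ⊢ <;> omega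

theorem notMem_box_of_notMem_succ {n : ℕ} {w : ℤ × ℤ} (h : w ∉ box (n + 1)) : w ∉ box n := by
  rw [mem_box] at h ⊢
  push_cast at h ⊢
  omega

/-- The discrete gradient of the field extended by zero, on the edges meeting the box. -/
noncomputable def gradient (n : ℕ) : (box n → ℤ) →+ (box (n + 1) × Bool → ℤ) where
  toFun Ψ e := extendZeroInt Ψ (e.1 + dir e.2) - extendZeroInt Ψ e.1
  map_zero' := by
    funext e
    simp [extendZeroInt]
  map_add' Ψ Φ := by
    funext e
    simp only [extendZeroInt, Pi.add_apply]
    split_ifs <;> ring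

theorem gradient_apply {n : ℕ} (Ψ : box n → ℤ) (e : box (n + 1) × Bool) :
    (gradient n Ψ e : ℝ) = extendZero Ψ (e.1 + dir e.2) - extendZero Ψ e.1 := by
  rw [extendZero_eq_intCast, extendZero_eq_intCast]
  simp [gradient]

theorem sum_edges {n : ℕ} (F : ℤ × ℤ → Bool → ℝ) :
    ∑ e : box n × Bool, F e.1 e.2 = ∑ w ∈ box n, (F w false + F w true) := by
  rw [Fintype.sum_prod_type, ← Finset.sum_coe_sort (box n)]
  exact Finset.sum_congr rfl fun w _ => by rw [Fintype.sum_bool, add_comm]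

section

variable {n : ℕ} (Ψ : box n → ℤ)

theorem summable_extendZero_mul (g : ℤ × ℤ → ℝ) : Summable fun w => extendZero Ψ w * g w :=
  summable_of_ne_finset_zero (s := box n) fun w hw => by
    rw [extendZero_of_notMem Ψ hw, zero_mul]

theorem tsum_extendZero_add_mul (g : ℤ × ℤ → ℝ) (e : ℤ × ℤ) :
    ∑' w, extendZero Ψ (w + e) * g w = ∑' w, extendZero Ψ w * g (w - e) := by
  rw [← (Equiv.addRight e).tsum_eq (fun w => extendZero Ψ w * g (w - e))]
  simp

theorem summable_extendZero_add_mul (g : ℤ × ℤ → ℝ) (e : ℤ × ℤ) :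
    Summable fun w => extendZero Ψ (w + e) * g w := by
  have := (Equiv.addRight e).summable_iff.2 (summable_extendZero_mul Ψ fun w => g (w - e))
  refine this.congr fun w => ?_
  simp

/-- Summation by parts. No boundary term appears, because the edges based in the box of radius `n +
1` include all those on which the gradient of the extended field can be nonzero. -/
theorem sum_gradient_mul (g : ℤ × ℤ → Bool → ℝ) :
    ∑ e : box (n + 1) × Bool, g e.1 e.2 * (gradient n Ψ e : ℝ)
      = ∑' w, extendZero Ψ w * ((g (w - dir false) false - g w false)
        + (g (w - dir true) true - g w true)) := by
  simp_rw [gradient_apply]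
  rw [sum_edges (n := n + 1) (F := fun w i => g w i * (extendZero Ψ (w + dir i) - extendZero Ψ w)),
    ← tsum_eq_sum (L := .unconditional _) (s := box (n + 1))
      (f := fun w => g w false * (extendZero Ψ (w + dir false) - extendZero Ψ w)
        + g w true * (extendZero Ψ (w + dir true) - extendZero Ψ w))]
  · have s1 := fun i => summable_extendZero_add_mul Ψ (fun w => g w i) (dir i)
    have s2 := fun i => summable_extendZero_mul Ψ (fun w => g w i)
    have s3 := fun i => summable_extendZero_mul Ψ (fun w => g (w - dir i) i)
    have key : ∀ i, ∑' w, g w i * (extendZero Ψ (w + dir i) - extendZero Ψ w)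
        = ∑' w, extendZero Ψ w * (g (w - dir i) i - g w i) := by
      intro i
      have e1 : ∀ w, g w i * (extendZero Ψ (w + dir i) - extendZero Ψ w)
          = extendZero Ψ (w + dir i) * g w i - extendZero Ψ w * g w i := fun w => by ring
      simp_rw [e1, mul_sub]
      rw [(s1 i).tsum_sub (s2 i), (s3 i).tsum_sub (s2 i),
        tsum_extendZero_add_mul Ψ (fun w => g w i)]
    have hs : ∀ i, Summable fun w => g w i * (extendZero Ψ (w + dir i) - extendZero Ψ w) :=
      fun i => ((s1 i).sub (s2 i)).congr fun w => by ring
    have hs' : ∀ i, Summable fun w => extendZero Ψ w * (g (w - dir i) i - g w i) :=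
      fun i => ((s3 i).sub (s2 i)).congr fun w => by ring
    rw [(hs false).tsum_add (hs true), key, key, ← (hs' false).tsum_add (hs' true)]
    exact tsum_congr fun w => by ring
  · intro w hw
    rw [extendZero_of_notMem Ψ (notMem_box_of_notMem_succ hw),
      extendZero_of_notMem Ψ (add_dir_notMem hw _), extendZero_of_notMem Ψ (add_dir_notMem hw _)]
    ring

theorem energy_eq_sum_gradient_sq :
    energy Ψ = ∑ e : box (n + 1) × Bool, (gradient n Ψ e : ℝ) ^ 2 := by
  have h : ∀ e : box (n + 1) × Bool, (gradient n Ψ e : ℝ) ^ 2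
      = (fun w i => extendZero Ψ (w + dir i) - extendZero Ψ w) (e.1 : ℤ × ℤ) e.2
        * (gradient n Ψ e : ℝ) := fun e => by
    simp only [sq]
    rw [← gradient_apply]
  simp_rw [h]
  rw [sum_gradient_mul Ψ (fun w i => extendZero Ψ (w + dir i) - extendZero Ψ w), energy,
    tsum_eq_sum (s := box n) fun w hw => by rw [extendZero_of_notMem Ψ hw, zero_mul],
    ← Finset.sum_coe_sort (box n)]
  refine Finset.sum_congr rfl fun v _ => ?_
  rw [← extendZero_coe Ψ v, sub_add_cancel, sub_add_cancel, laplacian]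
  have e1 : (v : ℤ × ℤ) + dir false = ((v : ℤ × ℤ).1 + 1, (v : ℤ × ℤ).2) := by
    ext <;> simp [dir]
  have e2 : (v : ℤ × ℤ) + dir true = ((v : ℤ × ℤ).1, (v : ℤ × ℤ).2 + 1) := by
    ext <;> simp [dir]
  have e3 : (v : ℤ × ℤ) - dir false = ((v : ℤ × ℤ).1 - 1, (v : ℤ × ℤ).2) := by
    ext <;> simp [dir]
  have e4 : (v : ℤ × ℤ) - dir true = ((v : ℤ × ℤ).1, (v : ℤ × ℤ).2 - 1) := by
    ext <;> simp [dir]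
  rw [e1, e2, e3, e4]
  ring

end

/-- The radial unit flow out of the origin. -/
noncomputable def flow (w : ℤ × ℤ) : Bool → ℝ
  | false => angle w.1 w.2 / (2 * Real.pi)
  | true => angle w.2 w.1 / (2 * Real.pi)

theorem flow_divergence (w : ℤ × ℤ) :
    (flow (w - dir false) false - flow w false) + (flow (w - dir true) true - flow w true)
      = if w = 0 then -1 else 0 := by
  have h := angle_divergence w.1 w.2
  have hpi := Real.pi_ne_zero
  have e : (if w = 0 then -1 else 0 : ℝ)
      = -(if (w.1, w.2) = (0, 0) then 2 * Real.pi else 0) / (2 * Real.pi) := by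
    change _ = -(if w = 0 then 2 * Real.pi else 0) / (2 * Real.pi)
    split_ifs
    · field_simp
    · simp
  rw [e, ← h]
  simp only [flow, dir, Prod.fst_sub, Prod.snd_sub, sub_zero]
  ring

theorem sum_flow_mul_gradient {n : ℕ} (Ψ : box n → ℤ) (v : box n) :
    ∑ e : box (n + 1) × Bool, flow (e.1 - v) e.2 * (gradient n Ψ e : ℝ) = -Ψ v := by
  rw [sum_gradient_mul Ψ (fun w i => flow (w - v) i)]
  have h : ∀ w : ℤ × ℤ, extendZero Ψ w * ((flow (w - dir false - v) false - flow (w - v) false)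
        + (flow (w - dir true - v) true - flow (w - v) true))
      = if w = v then -(Ψ v : ℝ) else 0 := by
    intro w
    rw [sub_right_comm w (dir false), sub_right_comm w (dir true), flow_divergence]
    simp only [sub_eq_zero]
    split_ifs with h
    · rw [h, extendZero_coe]; ring
    · ring
  simp_rw [h]
  rw [tsum_ite_eq]

/-- The flow representation recovers the field from its gradient. Injectivity reduces summability
over fields to summability of a product over edges. -/
theorem gradient_injective (n : ℕ) : Function.Injective (gradient n) := by
  rw [injective_iff_map_eq_zero]
  intro Ψ h
  funext v
  have := sum_flow_mul_gradient Ψ v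
  rw [h] at this
  simpa using this.symm

theorem sum_box_sub_le {n : ℕ} (v : box n) {F : ℤ × ℤ → ℝ} (hF : ∀ w, 0 ≤ F w) :
    ∑ w ∈ box (n + 1), F (w - v) ≤ ∑ w ∈ box (2 * n + 1), F w := by
  have hinj : Set.InjOn (fun w : ℤ × ℤ => w - v) (box (n + 1) : Set (ℤ × ℤ)) :=
    fun a _ b _ h => sub_left_injective h
  rw [← Finset.sum_image (f := F) hinj]
  refine Finset.sum_le_sum_of_subset_of_nonneg (fun w hw => ?_) fun w _ _ => hF w
  obtain ⟨u, hu, rfl⟩ := Finset.mem_image.1 hw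
  have hv := v.2
  rw [mem_box] at hu hv ⊢
  simp only [Prod.fst_sub, Prod.snd_sub]
  push_cast at hu hv ⊢
  omega

theorem sum_box_swap (R : ℕ) (F : ℤ → ℤ → ℝ) :
    ∑ w ∈ box R, F w.2 w.1 = ∑ w ∈ box R, F w.1 w.2 := by
  rw [box, Finset.sum_product, Finset.sum_product, Finset.sum_comm]

theorem sum_flow_pow_le {n : ℕ} (v : box n) {j : ℕ} (hj : Even j) :
    ∑ e : box (n + 1) × Bool, flow (e.1 - v) e.2 ^ j
      ≤ 2 * (∑ w ∈ box (2 * n + 1), angle w.1 w.2 ^ j) / (2 * Real.pi) ^ j := by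
  rw [sum_edges (F := fun w i => flow (w - v) i ^ j)]
  refine (sum_box_sub_le v (F := fun w => flow w false ^ j + flow w true ^ j)
    fun w => add_nonneg (hj.pow_nonneg _) (hj.pow_nonneg _)).trans (le_of_eq ?_)
  simp only [flow, div_pow]
  rw [Finset.sum_add_distrib, ← Finset.sum_div, ← Finset.sum_div,
    sum_box_swap _ fun x y => angle x y ^ j]
  ring

theorem sum_flow_sq_le {n : ℕ} (hn : 1 ≤ n) (v : box n) :
    ∑ e : box (n + 1) × Bool, flow (e.1 - v) e.2 ^ 2 ≤ Real.log n / (2 * Real.pi) + 3 := by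
  refine (sum_flow_pow_le v even_two).trans ?_
  have h := sum_box_angle_sq_le (2 * n + 1)
  have hn' : (1 : ℝ) ≤ n := by exact_mod_cast hn
  -- Recentring at `v` can enlarge the box to radius `2n + 1 ≤ 3n`, which costs only an additive
  -- constant.
  have hlog : Real.log ((2 * n + 1 : ℕ) : ℝ) ≤ Real.log n + 2 := by
    have h1 : ((2 * n + 1 : ℕ) : ℝ) ≤ n * 3 := by push_cast; linarith
    have h2 := Real.log_le_log (by positivity) h1
    rw [Real.log_mul (by positivity) (by norm_num)] at h2
    have h3 := Real.log_le_sub_one_of_pos (show (0 : ℝ) < 3 by norm_num)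
    linarith
  have hpi := Real.pi_gt_three
  have h1 := mul_le_mul_of_nonneg_left hlog Real.pi_pos.le
  rw [div_le_iff₀ (by positivity)]
  have e : (Real.log n / (2 * Real.pi) + 3) * (2 * Real.pi) ^ 2
      = 2 * Real.pi * Real.log n + 12 * Real.pi ^ 2 := by
    field_simp; ring
  rw [e]
  nlinarith

theorem sum_flow_pow_four_le {n : ℕ} (v : box n) :
    ∑ e : box (n + 1) × Bool, flow (e.1 - v) e.2 ^ 4 ≤ 1 := by
  refine (sum_flow_pow_le v (by decide)).trans ?_
  have h := sum_box_angle_pow_four_le (2 * n + 1)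
  have hpi := Real.pi_gt_three
  rw [div_le_one (by positivity)]
  have : (6 : ℝ) ^ 4 ≤ (2 * Real.pi) ^ 4 := pow_le_pow_left₀ (by norm_num) (by linarith) 4
  linarith

/-! ### The maximum of the integer-valued Gaussian free field -/

theorem exp_neg_energy {β : ℝ} {n : ℕ} (Ψ : box n → ℤ) :
    Real.exp (-(1 / (2 * β) * energy Ψ)) = ∏ e, edgeWeight β 0 (gradient n Ψ e) := by
  rw [energy_eq_sum_gradient_sq, Finset.mul_sum, ← Finset.sum_neg_distrib, Real.exp_sum]
  refine Finset.prod_congr rfl fun e _ => ?_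
  rw [edgeWeight]
  congr 1
  ring

theorem exp_neg_energy_mul_exp {β l : ℝ} {n : ℕ} (Ψ : box n → ℤ) (v : box n) :
    Real.exp (-(1 / (2 * β) * energy Ψ)) * Real.exp (l * Ψ v)
      = ∏ e : box (n + 1) × Bool, edgeWeight β (-(l * flow (e.1 - v) e.2)) (gradient n Ψ e) := by
  have h : l * (Ψ v : ℝ) = ∑ e : box (n + 1) × Bool,
      -(l * flow (e.1 - v) e.2) * (gradient n Ψ e : ℝ) := by
    have := sum_flow_mul_gradient Ψ v
    rw [← neg_eq_iff_eq_neg] at this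
    rw [← this, ← Finset.sum_neg_distrib, Finset.mul_sum]
    exact Finset.sum_congr rfl fun e _ => by ring
  rw [exp_neg_energy, h, Real.exp_sum, ← Finset.prod_mul_distrib]
  refine Finset.prod_congr rfl fun e _ => ?_
  rw [edgeWeight, edgeWeight, ← Real.exp_add]
  congr 1
  ring

theorem summable_prod_edgeWeight_gradient {β : ℝ} (hβ : 0 < β) (n : ℕ)
    (s : box (n + 1) × Bool → ℝ) :
    Summable fun Ψ : box n → ℤ => ∏ e, edgeWeight β (s e) (gradient n Ψ e) :=
  (summable_pi_prod (f := fun e => edgeWeight β (s e)) (fun _ _ => (edgeWeight_pos _ _ _).le)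
    fun _ => summable_edgeWeight hβ _).comp_injective (gradient_injective n)

theorem summable_exp_neg_energy {β : ℝ} (hβ : 0 < β) (n : ℕ) :
    Summable fun Ψ : box n → ℤ => Real.exp (-(1 / (2 * β) * energy Ψ)) := by
  simp_rw [exp_neg_energy]
  exact summable_prod_edgeWeight_gradient hβ n fun _ => 0

theorem isProbabilityMeasure_law {β : ℝ} (hβ : 0 < β) (n : ℕ) :
    IsProbabilityMeasure (law β n) :=
  isProbabilityMeasure_gibbs (summable_exp_neg_energy hβ n)

theorem integrable_exp_law {β : ℝ} (hβ : 0 < β) {n : ℕ} (l : ℝ) (v : box n) :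
    Integrable (fun Ψ : box n → ℤ => Real.exp (l * Ψ v)) (law β n) := by
  refine integrable_gibbs (summable_exp_neg_energy hβ n) ?_
  simp_rw [Real.norm_of_nonneg (Real.exp_pos _).le, exp_neg_energy_mul_exp]
  exact summable_prod_edgeWeight_gradient hβ n _

/-- The Laplace transform of the field at a vertex, with the reduced effective temperature. -/
theorem exists_mgf_law_le {β : ℝ} (hβ : 0 < β) :
    ∃ K : ℝ, 0 ≤ K ∧ ∀ n : ℕ, 1 ≤ n → ∀ (v : box n) (l : ℝ),
      mgf (fun Ψ : box n → ℤ => (Ψ v : ℝ)) (law β n) l ≤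
        Real.exp (β * (1 - errorM β) / 2 * l ^ 2 * (Real.log n / (2 * Real.pi) + 3)
          + K * l ^ 4) := by
  obtain ⟨K, hK0, hK⟩ := norm_symbol_edgeWeight_le hβ
  refine ⟨K, hK0, fun n hn v l => ?_⟩
  have hZ := summable_exp_neg_energy hβ n
  have hZpos := tsum_exp_pos hZ
  set s : box (n + 1) × Bool → ℝ := fun e => -(l * flow (e.1 - v) e.2)
  set C : box (n + 1) × Bool → ℝ :=
    fun e => Real.exp (β * (1 - errorM β) / 2 * s e ^ 2 + K * s e ^ 4)
  have hcomp := sum_prod_le_of_norm_symbol_le (g := fun e => edgeWeight β (s e))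
    (g₀ := fun _ => edgeWeight β 0) (C := C) (r := fun _ t => ‖symbol (edgeWeight β 0) t‖)
    (fun e => summable_edgeWeight hβ _) (fun e => summable_edgeWeight hβ _)
    (fun e k => (edgeWeight_pos _ _ _).le) (fun e k => (edgeWeight_pos _ _ _).le) (gradient n)
    (summable_prod_edgeWeight_gradient hβ n fun _ => 0) (fun e => (Real.exp_pos _).le)
    (fun e t => symbol_edgeWeight_zero hβ t) (fun e t => hK (s e) t)
  have hsum := (summable_prod_edgeWeight_gradient hβ n s).tsum_le_of_sum_le hcomp
  have hC : ∏ e, C e ≤ Real.exp (β * (1 - errorM β) / 2 * l ^ 2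
      * (Real.log n / (2 * Real.pi) + 3) + K * l ^ 4) := by
    rw [← Real.exp_sum, Finset.sum_add_distrib, ← Finset.mul_sum, ← Finset.mul_sum]
    refine Real.exp_le_exp.2 (add_le_add ?_ ?_)
    · have e : ∑ e, s e ^ 2 = l ^ 2 * ∑ e : box (n + 1) × Bool, flow (e.1 - v) e.2 ^ 2 := by
        rw [Finset.mul_sum]
        exact Finset.sum_congr rfl fun e _ => by simp only [s]; ring
      rw [e, mul_assoc]
      -- The sign of `1 - M(β)` matters: the energy of the flow is only bounded from above.
      have hM := errorM_le_one hβ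
      refine mul_le_mul_of_nonneg_left
        (mul_le_mul_of_nonneg_left (sum_flow_sq_le hn v) (sq_nonneg l)) ?_
      have : 0 ≤ β * (1 - errorM β) := mul_nonneg hβ.le (by linarith)
      linarith
    · have e : ∑ e, s e ^ 4 = l ^ 4 * ∑ e : box (n + 1) × Bool, flow (e.1 - v) e.2 ^ 4 := by
        rw [Finset.mul_sum]
        exact Finset.sum_congr rfl fun e _ => by simp only [s]; ring
      rw [e]
      refine mul_le_mul_of_nonneg_left ?_ hK0
      exact mul_le_of_le_one_right (by positivity) (sum_flow_pow_four_le v)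
  rw [mgf, law, integral_gibbs hZ, smul_eq_mul, inv_mul_le_iff₀ hZpos]
  simp_rw [smul_eq_mul, exp_neg_energy_mul_exp]
  refine hsum.trans ?_
  rw [mul_comm]
  simp_rw [exp_neg_energy]
  exact mul_le_mul_of_nonneg_left hC
    (tsum_nonneg fun Ψ => Finset.prod_nonneg fun e _ => (edgeWeight_pos _ _ _).le)

theorem zero_mem_box (n : ℕ) : ((0, 0) : ℤ × ℤ) ∈ box n := by
  rw [mem_box]; simp

theorem card_box (n : ℕ) : (box n).card = (2 * n + 1) ^ 2 := by
  have : ((n : ℤ) + 1 - -n).toNat = 2 * n + 1 := by omega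
  rw [box, Finset.card_product, Int.card_Icc, this, sq]

theorem measureReal_le_fieldMax_le {β : ℝ} (hβ : 0 < β) {n : ℕ} {t B : ℝ}
    (h : ∀ v : box n, (law β n).real {Ψ | t ≤ (Ψ v : ℝ)} ≤ B) :
    (law β n).real {Ψ | t ≤ fieldMax Ψ} ≤ (2 * n + 1) ^ 2 * B := by
  have := isProbabilityMeasure_law hβ n
  have : Nonempty (box n) := ⟨⟨_, zero_mem_box n⟩⟩
  have hsub : {Ψ : box n → ℤ | t ≤ fieldMax Ψ} ⊆ ⋃ v : box n, {Ψ | t ≤ (Ψ v : ℝ)} := by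
    intro Ψ hΨ
    obtain ⟨v, hv⟩ := exists_eq_ciSup_of_finite (f := fun v : box n => (Ψ v : ℝ))
    refine Set.mem_iUnion.2 ⟨v, ?_⟩
    have h1 : t ≤ fieldMax Ψ := hΨ
    rw [fieldMax, ← hv] at h1
    exact h1
  refine (measureReal_mono hsub).trans ((measureReal_iUnion_fintype_le _).trans ?_)
  refine (Finset.sum_le_sum fun v _ => h v).trans (le_of_eq ?_)
  rw [Finset.sum_const, Finset.card_univ, Fintype.card_coe, card_box, nsmul_eq_mul]
  push_cast
  rfl

theorem tendsto_measure_le_fieldMax {β : ℝ} (hβ : 0 < β) {β' : ℝ}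
    (hβ' : (1 - errorM β) * β < β') :
    Tendsto (fun n : ℕ => law β n
      {Ψ | 2 / Real.sqrt (2 * Real.pi * β'⁻¹) * Real.log n ≤ fieldMax Ψ}) atTop (𝓝 0) := by
  obtain ⟨K, hK0, hK⟩ := exists_mgf_law_le hβ
  have hM := errorM_le_one hβ
  have hκ : 0 ≤ (1 - errorM β) * β := mul_nonneg (by linarith) hβ.le
  have hβ'0 : 0 < β' := hκ.trans_lt hβ'
  have hpi := Real.pi_pos
  set κ := (1 - errorM β) * β
  set c := 2 / Real.sqrt (2 * Real.pi * β'⁻¹)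
  have hc : 0 < c := by positivity
  have hc2 : c ^ 2 = 2 * β' / Real.pi := by
    rw [div_pow, Real.sq_sqrt (by positivity)]
    field_simp
  -- The optimal Chernoff parameter for variance `β' log n / (2π)` at level `c log n`. It gives each
  -- vertex the probability bound `n ^ (-4 + 2 κ / β')` up to a constant, and the `O(n²)` vertices
  -- leave `n ^ (-δ)`.
  set l := 2 * Real.pi * c / β'
  have hl : 0 ≤ l := by positivity
  have hlc : l * c = 4 := by
    have : l * c = 2 * Real.pi * c ^ 2 / β' := by simp only [l]; ring
    rw [this, hc2]; field_simp; norm_num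
  have hl2 : l ^ 2 = 8 * Real.pi / β' := by
    have : l ^ 2 = 4 * Real.pi ^ 2 * c ^ 2 / β' ^ 2 := by simp only [l]; ring
    rw [this, hc2]; field_simp; norm_num
  set A := κ / 2 * l ^ 2 * 3 + K * l ^ 4
  set δ := 2 - 2 * (κ / β')
  have hδ : 0 < δ := by
    have : κ / β' < 1 := (div_lt_one hβ'0).2 hβ'
    simp only [δ]; linarith
  have hbound : ∀ n : ℕ, 1 ≤ n → (law β n).real {Ψ | c * Real.log n ≤ fieldMax Ψ}
      ≤ 9 * Real.exp A * Real.exp (-(δ * Real.log n)) := by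
    intro n hn
    have := isProbabilityMeasure_law hβ n
    have hn' : (1 : ℝ) ≤ n := by exact_mod_cast hn
    have h1 := measureReal_le_fieldMax_le hβ (n := n) (t := c * Real.log n)
      (B := Real.exp A * Real.exp (-((δ + 2) * Real.log n))) fun v => by
        refine (measure_ge_le_exp_mul_mgf _ hl (integrable_exp_law hβ l v)).trans ?_
        refine (mul_le_mul_of_nonneg_left (hK n hn v l) (Real.exp_pos _).le).trans (le_of_eq ?_)
        rw [← Real.exp_add, ← Real.exp_add]
        congr 1
        have e1 : -l * (c * Real.log n) = -4 * Real.log n := by rw [← hlc]; ring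
        have e2 : β * (1 - errorM β) / 2 * l ^ 2 * (Real.log n / (2 * Real.pi) + 3)
            = 2 * (κ / β') * Real.log n + κ / 2 * l ^ 2 * 3 := by
          simp only [κ]; rw [hl2]; field_simp; ring
        rw [e1, e2]
        simp only [A, δ]
        ring
    refine h1.trans ?_
    have h2 : (2 * (n : ℝ) + 1) ^ 2 ≤ 9 * Real.exp (2 * Real.log n) := by
      have : Real.exp (2 * Real.log n) = (n : ℝ) ^ 2 := by
        rw [two_mul, Real.exp_add, Real.exp_log (by linarith), sq]
      rw [this]
      nlinarith
    refine (mul_le_mul_of_nonneg_right h2 (by positivity)).trans (le_of_eq ?_)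
    have h3 : Real.exp (-(δ * Real.log n))
        = Real.exp (2 * Real.log n) * Real.exp (-((δ + 2) * Real.log n)) := by
      rw [← Real.exp_add]; congr 1; ring
    rw [h3]
    ring
  have hlim : Tendsto (fun n : ℕ => 9 * Real.exp A * Real.exp (-(δ * Real.log n))) atTop (𝓝 0) := by
    have h1 : Tendsto (fun n : ℕ => δ * Real.log n) atTop atTop :=
      (Real.tendsto_log_atTop.comp tendsto_natCast_atTop_atTop).const_mul_atTop hδ
    have h2 := (Real.tendsto_exp_neg_atTop_nhds_zero.comp h1).const_mul (9 * Real.exp A)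
    rwa [mul_zero] at h2
  have hlim' := ENNReal.tendsto_ofReal hlim
  rw [ENNReal.ofReal_zero] at hlim'
  refine tendsto_of_tendsto_of_tendsto_of_le_of_le' tendsto_const_nhds hlim'
    (Eventually.of_forall fun _ => bot_le) ?_
  filter_upwards [eventually_ge_atTop 1] with n hn
  have := isProbabilityMeasure_law hβ n
  rw [← ofReal_measureReal]
  exact ENNReal.ofReal_le_ofReal (hbound n hn)

theorem tendsto_measure_fieldMax_le {β : ℝ} (hβ : 0 < β) :
    Tendsto (fun n : ℕ => law β n {Ψ | fieldMax Ψ ≤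
      Real.sqrt ((1 - errorM β / 2) * (2 * β) / Real.pi) * Real.log n}) atTop (𝓝 1) := by
  have hM0 := errorM_pos hβ
  have hM1 := errorM_le_one hβ
  have hpi := Real.pi_pos
  have hb : 0 < (1 - errorM β / 2) * β := mul_pos (by linarith) hβ
  have h0 := tendsto_measure_le_fieldMax hβ (β' := (1 - errorM β / 2) * β)
    (mul_lt_mul_of_pos_right (by linarith) hβ)
  -- Both sides equal `√(2β'/π)` for `β' = (1 - M(β)/2) β`.
  have hc : 2 / Real.sqrt (2 * Real.pi * ((1 - errorM β / 2) * β)⁻¹)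
      = Real.sqrt ((1 - errorM β / 2) * (2 * β) / Real.pi) := by
    symm
    rw [Real.sqrt_eq_iff_mul_self_eq (by
      have : (1 - errorM β / 2) * (2 * β) = 2 * ((1 - errorM β / 2) * β) := by ring
      rw [this]; positivity) (by positivity), div_mul_div_comm,
      Real.mul_self_sqrt (by positivity)]
    have h1 : 1 - errorM β / 2 ≠ 0 := by linarith
    field_simp
  rw [hc] at h0
  have h1 : Tendsto (fun n : ℕ => 1 - law β n
      {Ψ | Real.sqrt ((1 - errorM β / 2) * (2 * β) / Real.pi) * Real.log n ≤ fieldMax Ψ})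
      atTop (𝓝 (1 - 0)) :=
    ENNReal.Tendsto.sub tendsto_const_nhds h0 (Or.inl ENNReal.one_ne_top)
  rw [tsub_zero] at h1
  refine tendsto_of_tendsto_of_tendsto_of_le_of_le h1 tendsto_const_nhds (fun n => ?_)
    fun n => ?_
  · have := isProbabilityMeasure_law hβ n
    simp only
    rw [← prob_compl_eq_one_sub (Set.to_countable _).measurableSet]
    refine measure_mono fun Ψ hΨ => ?_
    have h2 : ¬ _ ≤ fieldMax Ψ := hΨ
    exact (not_le.1 h2).le
  · have := isProbabilityMeasure_law hβ n
    exact prob_le_one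

end IVGFF

theorem mainTheorem4 (β : ℝ) (hβ : 0 < β) :
    (∀ n : ℕ, IsProbabilityMeasure (IVGFF.law β n)) ∧
    Tendsto
      (fun n : ℕ => IVGFF.law β n
        {Ψ | IVGFF.fieldMax Ψ ≤
          Real.sqrt ((1 - IVGFF.errorM β / 2) * (2 * β) / Real.pi) * Real.log n})
      atTop (𝓝 1) ∧
    ∀ β' : ℝ, (1 - IVGFF.errorM β) * β < β' →
      Tendsto
        (fun n : ℕ => IVGFF.law β n
          {Ψ | 2 / Real.sqrt (2 * Real.pi * β'⁻¹) * Real.log n ≤ IVGFF.fieldMax Ψ})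
        atTop (𝓝 0) :=
  ⟨IVGFF.isProbabilityMeasure_law hβ, IVGFF.tendsto_measure_fieldMax_le hβ,
    fun _ => IVGFF.tendsto_measure_le_fieldMax hβ⟩
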